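/- Let $N\ge 1$ be an integer, $S_0>0$, $\Delta t>0$, $\mu,r\in\mathbb R$ and $0<\sigma<\frac1{2\Delta t}$. On $\mathbb R^N$ with coordinates $y_1,\dots,y_N$, let $\mathcal F_n=\sigma(y_1,\dots,y_n)$, let $P=P_1^{\otimes N}$, where $P_1=N(0,\Delta t)$ is the centred Gaussian law of variance $\Delta t$, and put $\zeta_n=y_1+\dots+y_n$. The discounted price of the risky asset is $$S_n=S_0e^{(\mu-\frac{\sigma^2}{2}-r)n\Delta t+\sigma\zeta_n}=(1+\rho(y_n))S_{n-1},\qquad \rho(y)=e^{(\mu-\frac{\sigma^2}{2}-r)\Delta t+\sigma y}-1 .$$ Let $\Omega^-=\{\rho\le 0\}$, $\Omega^+=\{\rho>0\}$, $\rho^\pm=\max(\pm\rho,0)$, and let $\nu=P_1|_{\Omega^-}\times P_1|_{\Omega^+}$. Let $M_1^0$ be the set of all measures on $\mathbb R$ of the form $$Q(A)=\int\Big[\chi_A(y_1)\frac{\rho^+(y_2)}{\rho^-(y_1)+\rho^+(y_2)}+\chi_A(y_2)\frac{\rho^-(y_1)}{\rho^-(y_1)+\rho^+(y_2)}\Big]\alpha(y_1,y_2)\,d\nu(y_1,y_2),$$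 where $\alpha\ge0$ is measurable, $\alpha>0$ $\nu$-almost everywhere, $\int\alpha\,d\nu=1$ and $\int\alpha\,\frac{\rho^-(y_1)\rho^+(y_2)}{\rho^-(y_1)+\rho^+(y_2)}\,d\nu<\infty$. Let $M^N=\{Q_1\times\dots\times Q_N:\ Q_i\in M_1^0\}$ and let $M_0^N$ be the convex hull of $M^N$. Let $f$ be a real Borel function such that for every $s>0$ and every $c<f(s)$, the set $\{f>c\}$ meets every neighbourhood of $s$ in a set of positive Lebesgue measure (this holds, for instance, if $f$ is lower semicontinuous, or if at every point it is continuous from the left or from the right). Suppose that $f(S_N)$ is integrable with respect to every $Q\in M_0^N$ and that $\sup_{Q\in M_0^N}E^Qf(S_N)<\infty$. The fair price of the super-hedge of the payment $f(S_N)$ is the infimum of all $x\in\mathbb R$ for which there are $\mathcal F_{n-1}$-measurable $H_n$, $n=1,\dots,N$, with $$x+\sum_{n=1}^N H_n(S_n-S_{n-1})\ \ge\ f(S_N)\qquad P\text{-almost surely.}$$ Then this fair price equals $\sup_{Q\in M_0^N}E^Qf(S_N)$, and $$\sup_{Q\in M_0^N}E^Qf(S_N)=\sup_{\substack{y_s^1\le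 -d,\ y_s^2>-d\\ s=1,\dots,N}}\ \sum_{i_1,\dots,i_N=1}^{2} f\Big(S_0\prod_{s=1}^N\big(1+\rho(y_s^{i_s})\big)\Big)\prod_{s=1}^N\frac{\big|e^{\sigma(d+y_s^{i_s+1})}-1\big|}{\big|e^{\sigma(d+y_s^{i_s+1})}-e^{\sigma(d+y_s^{i_s})}\big|},$$ where $d=\frac{(\mu-\frac{\sigma^2}{2}-r)\Delta t}{\sigma}$ and $y_s^3=y_s^1$. -/

import Mathlib

open MeasureTheory ProbabilityTheory
open scoped NNReal ENNReal Topology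

namespace DriftedGBM

noncomputable section

/-- The space of paths `y = (y_1, …, y_N)` of the `N` increments of the discrete Brownian motion. -/
abbrev Path (N : ℕ) : Type := Fin N → ℝ

/-- The law of one increment: centred Gaussian with variance `Δt`. -/
def stepLaw (Δt : ℝ) : Measure ℝ := gaussianReal 0 Δt.toNNReal

/-- The reference measure: the product law of the `N` independent increments. -/
def pathLaw (Δt : ℝ) (N : ℕ) : Measure (Path N) := Measure.pi fun _ => stepLaw Δt

/-- The discrete Brownian motion `ζ_n = y_1 + ⋯ + y_n`. -/
def zeta {N : ℕ} (n : ℕ) (y : Path N) : ℝ :=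
  ∑ i ∈ Finset.univ.filter (fun i : Fin N => i.val < n), y i

/-- The discounted price `S_n = S_0 exp ((μ - σ²/2 - r) n Δt + σ ζ_n)`. -/
def price {N : ℕ} (S₀ μ σ r Δt : ℝ) (n : ℕ) (y : Path N) : ℝ :=
  S₀ * Real.exp ((μ - σ ^ 2 / 2 - r) * n * Δt + σ * zeta n y)

/-- The one-step return `ρ(y) = exp ((μ - σ²/2 - r) Δt + σ y) - 1`, so `S_n = (1 + ρ(y_n)) S_{n-1}`. -/
def rho (μ σ r Δt : ℝ) (y : ℝ) : ℝ := Real.exp ((μ - σ ^ 2 / 2 - r) * Δt + σ * y) - 1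

/-! ### Martingale measures -/

section OneStep

variable (P : Measure ℝ) (ρ : ℝ → ℝ)

/-- `Ω⁻ = {ρ ≤ 0}`. -/
def lossSet : Set ℝ := {y | ρ y ≤ 0}

/-- `Ω⁺ = {ρ > 0}`. -/
def gainSet : Set ℝ := {y | 0 < ρ y}

/-- The product `P⁻ × P⁺` of the restrictions of `P` to `Ω⁻` and `Ω⁺`. -/
def pairLaw : Measure (ℝ × ℝ) := (P.restrict (lossSet ρ)).prod (P.restrict (gainSet ρ))

/-- `ρ⁺(y₂) / (ρ⁻(y₁) + ρ⁺(y₂))`, the mass that a pair `(y₁, y₂)` puts on `y₁`. -/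
def lossMass (p : ℝ × ℝ) : ℝ := max (ρ p.2) 0 / (max (-ρ p.1) 0 + max (ρ p.2) 0)

/-- `ρ⁻(y₁) / (ρ⁻(y₁) + ρ⁺(y₂))`, the mass that a pair `(y₁, y₂)` puts on `y₂`. -/
def gainMass (p : ℝ × ℝ) : ℝ := max (-ρ p.1) 0 / (max (-ρ p.1) 0 + max (ρ p.2) 0)

/-- The conditions on the mixing density `α`: positive almost everywhere on `Ω⁻ × Ω⁺`,
with `∫ α ρ⁻ρ⁺/(ρ⁻+ρ⁺) < ∞` and `∫ α = 1`. -/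
structure IsMixingDensity (α : ℝ × ℝ → ℝ≥0) : Prop where
  measurable : Measurable α
  pos : pairLaw P ρ {p | 0 < α p} = P (gainSet ρ) * P (lossSet ρ)
  finite : ∫⁻ p, α p * ENNReal.ofReal
    (max (-ρ p.1) 0 * max (ρ p.2) 0 / (max (-ρ p.1) 0 + max (ρ p.2) 0)) ∂(pairLaw P ρ) < ∞
  total : ∫⁻ p, α p ∂(pairLaw P ρ) = 1

/-- The set `M_1^0` of one-step measures: mixtures, with an admissible density `α`, of the
two-point measures carried by `(y₁, y₂) ∈ Ω⁻ × Ω⁺`. -/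
def oneStepMeasures : Set (Measure ℝ) :=
  {Q | ∃ α : ℝ × ℝ → ℝ≥0, IsMixingDensity P ρ α ∧ ∀ A : Set ℝ, MeasurableSet A →
    Q A = ∫⁻ p, A.indicator 1 p.1 * α p * ENNReal.ofReal (lossMass ρ p) ∂(pairLaw P ρ)
        + ∫⁻ p, A.indicator 1 p.2 * α p * ENNReal.ofReal (gainMass ρ p) ∂(pairLaw P ρ)}

end OneStep

/-- The set `M^N` of product measures `Q_1 × ⋯ × Q_N` with all `Q_i ∈ M_1^0`. -/
def productMeasures (μ σ r Δt : ℝ) (N : ℕ) : Set (Measure (Path N)) :=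
  {Q | ∃ q : Fin N → Measure ℝ,
    (∀ i, q i ∈ oneStepMeasures (stepLaw Δt) (rho μ σ r Δt)) ∧ Q = Measure.pi q}

/-- The set `M_0^N`, the convex hull of `M^N`. -/
def martingaleMeasures (μ σ r Δt : ℝ) (N : ℕ) : Set (Measure (Path N)) :=
  convexHull ℝ≥0 (productMeasures μ σ r Δt N)

/-! ### Super-hedging -/

/-- The σ-algebra `ℱ_n` generated by the first `n` coordinates. -/
abbrev coordSigma (N n : ℕ) : MeasurableSpace (Path N) :=
  ⨆ (i : Fin N) (_ : i.val < n), MeasurableSpace.comap (fun y : Path N => y i) inferInstance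

/-- Initial capitals `x` from which some self-financing strategy, holding `H_n` units of the risky
asset over the `n`-th period with `H_n` measurable with respect to `ℱ_{n-1}`, has an almost surely
sufficient discounted terminal wealth: `x + ∑ H_n (S_n - S_{n-1}) ≥ f(S_N)`.
(The periods `1, …, N` are indexed by `i = n - 1 : Fin N`.) -/
def superHedgeCapitals (S₀ μ σ r Δt : ℝ) (N : ℕ) (f : ℝ → ℝ) : Set ℝ :=
  {x | ∃ H : Fin N → Path N → ℝ, (∀ i, Measurable[coordSigma N i.val] (H i)) ∧
    ∀ᵐ y ∂(pathLaw Δt N), f (price S₀ μ σ r Δt N y) ≤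
      x + ∑ i : Fin N,
        H i y * (price S₀ μ σ r Δt (i.val + 1) y - price S₀ μ σ r Δt i.val y)}

/-- The fair price of the super-hedge of the payment `f(S_N)`: the infimum of the super-hedging
initial capitals, as an extended real number. -/
def superHedgePrice (S₀ μ σ r Δt : ℝ) (N : ℕ) (f : ℝ → ℝ) : EReal :=
  ⨅ x ∈ superHedgeCapitals S₀ μ σ r Δt N f, (x : EReal)

/-! ### The two-point formula -/

/-- `d = (μ - σ²/2 - r) Δt / σ`. -/
def shift (μ σ r Δt : ℝ) : ℝ := (μ - σ ^ 2 / 2 - r) * Δt / σ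

/-- The families `(y_s^1, y_s^2)`, `s = 1, …, N`, with `y_s^1 ≤ -d < y_s^2`; the upper indices
`1, 2` are `0, 1 : Fin 2`. -/
def pairFamilies (μ σ r Δt : ℝ) (N : ℕ) : Set (Fin N → Fin 2 → ℝ) :=
  {y | ∀ s, y s 0 ≤ -shift μ σ r Δt ∧ -shift μ σ r Δt < y s 1}

/-- The sum over `(i_1, …, i_N) ∈ {1, 2}^N` of `f (S_0 ∏ (1 + ρ(y_s^{i_s})))` times
`∏ |e^{σ(d + y_s^{i_s+1})} - 1| / |e^{σ(d + y_s^{i_s+1})} - e^{σ(d + y_s^{i_s})}|`;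
addition in `Fin 2` implements the convention `y_s^3 = y_s^1`. -/
def twoPointValue (S₀ μ σ r Δt : ℝ) (N : ℕ) (f : ℝ → ℝ) (y : Fin N → Fin 2 → ℝ) : ℝ :=
  ∑ i : Fin N → Fin 2,
    f (S₀ * ∏ s, (1 + rho μ σ r Δt (y s (i s)))) *
      ∏ s, |Real.exp (σ * (shift μ σ r Δt + y s (i s + 1))) - 1| /
        |Real.exp (σ * (shift μ σ r Δt + y s (i s + 1)))
          - Real.exp (σ * (shift μ σ r Δt + y s (i s)))|

end

end DriftedGBM

namespace DriftedGBM

/-! ### Prices and two-point weights -/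

/-! For at least one period, all three quantities equal the value at `S₀` of the concave envelope of
`f` on `(0, ∞)`, that is, the supremum of the chords of `f` over intervals `[a, b]` with `a ≤ S₀ <
b`, evaluated at `S₀`. Write `T` for the supremum of the two-point values and `W` for the supremum
of the expectations. The proof closes the cycle price ≤ `T` ≤ `W` ≤ price.

If `V` bounds every such chord, then `f` lies below a line of height `V` at `S₀`
(`exists_supporting_line`). Holding a constant number of units equal to the slope super-hedges from
capital `V`, and every two-point value is at most `V`, because it is an expectation of `f` under a
law of mean `S₀` (`twoPointValue_le`). Every chord is a two-point value: the first pair carries the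
chord and each later pair puts all its mass on `-d`, where the return vanishes
(`exists_twoPointValue_eq_chord`). With `V = T` this gives price ≤ `T`.

For `T` ≤ `W` it suffices that `W` bounds the chords (`chord_le`). Densities that vanish are
admitted by perturbation (`integral_le_of_relaxed`). The first factor is then concentrated near the
ends of the chord and the others near `-d`, and continuity of translation absorbs the small
displacement of the later steps. Finally `W` ≤ price is weak duality, by conditioning on one step at
a time (`integral_le_of_superhedge`). -/

theorem one_add_rho {σ : ℝ} (hσ : σ ≠ 0) (μ r Δt y : ℝ) :
    1 + rho μ σ r Δt y = Real.exp (σ * (shift μ σ r Δt + y)) := by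
  unfold rho shift
  rw [add_sub_cancel]
  congr 1
  field_simp

theorem rho_eq {σ : ℝ} (hσ : σ ≠ 0) (μ r Δt y : ℝ) :
    rho μ σ r Δt y = Real.exp (σ * (shift μ σ r Δt + y)) - 1 := by
  rw [← one_add_rho hσ]; ring

theorem one_add_rho_pos (μ σ r Δt y : ℝ) : 0 < 1 + rho μ σ r Δt y := by
  unfold rho; linarith [Real.exp_pos ((μ - σ ^ 2 / 2 - r) * Δt + σ * y)]

theorem rho_nonpos_iff {σ : ℝ} (hσ : 0 < σ) (μ r Δt y : ℝ) :
    rho μ σ r Δt y ≤ 0 ↔ y ≤ -shift μ σ r Δt := by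
  rw [rho_eq hσ.ne', sub_nonpos, Real.exp_le_one_iff]
  constructor
  · intro h; nlinarith
  · intro h; nlinarith

theorem rho_pos_iff {σ : ℝ} (hσ : 0 < σ) (μ r Δt y : ℝ) :
    0 < rho μ σ r Δt y ↔ -shift μ σ r Δt < y := by
  rw [← not_le, rho_nonpos_iff hσ, not_le]

theorem measurable_rho (μ σ r Δt : ℝ) : Measurable (rho μ σ r Δt) := by
  unfold rho; fun_prop

theorem continuous_rho (μ σ r Δt : ℝ) : Continuous (rho μ σ r Δt) := by
  unfold rho; fun_prop

theorem exists_one_add_rho_eq {σ : ℝ} (hσ : σ ≠ 0) (μ r Δt : ℝ) {t : ℝ} (ht : 0 < t) :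
    ∃ y, 1 + rho μ σ r Δt y = t := by
  refine ⟨Real.log t / σ - shift μ σ r Δt, ?_⟩
  rw [one_add_rho hσ]
  rw [show σ * (shift μ σ r Δt + (Real.log t / σ - shift μ σ r Δt)) = Real.log t by
    field_simp; ring]
  exact Real.exp_log ht

theorem price_eq_prod {N : ℕ} (S₀ μ σ r Δt : ℝ) (y : Path N) :
    price S₀ μ σ r Δt N y = S₀ * ∏ i, (1 + rho μ σ r Δt (y i)) := by
  unfold price rho zeta
  simp only [add_sub_cancel, ← Real.exp_sum, Finset.sum_add_distrib, ← Finset.mul_sum]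
  congr 2
  simp
  ring

theorem zeta_succ {N : ℕ} (i : Fin N) (y : Path N) : zeta (i.val + 1) y = zeta i.val y + y i := by
  unfold zeta
  rw [show Finset.univ.filter (fun j : Fin N => j.val < i.val + 1)
      = insert i (Finset.univ.filter (fun j : Fin N => j.val < i.val)) by
    ext j
    simp only [Finset.mem_filter, Finset.mem_univ, true_and, Finset.mem_insert, Fin.ext_iff]
    omega]
  rw [Finset.sum_insert (by simp), add_comm]

theorem price_zero {N : ℕ} (S₀ μ σ r Δt : ℝ) (y : Path N) : price S₀ μ σ r Δt 0 y = S₀ := by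
  simp [price, zeta]

theorem price_succ_sub {N : ℕ} (S₀ μ σ r Δt : ℝ) (i : Fin N) (y : Path N) :
    price S₀ μ σ r Δt (i.val + 1) y - price S₀ μ σ r Δt i.val y
      = price S₀ μ σ r Δt i.val y * rho μ σ r Δt (y i) := by
  unfold price rho
  rw [zeta_succ, show (μ - σ ^ 2 / 2 - r) * ((i.val + 1 : ℕ) : ℝ) * Δt + σ * (zeta i.val y + y i)
      = ((μ - σ ^ 2 / 2 - r) * i.val * Δt + σ * zeta i.val y)
        + ((μ - σ ^ 2 / 2 - r) * Δt + σ * y i) by push_cast; ring, Real.exp_add]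
  ring

theorem sum_price_sub {N : ℕ} (S₀ μ σ r Δt : ℝ) (y : Path N) :
    ∑ i : Fin N, (price S₀ μ σ r Δt (i.val + 1) y - price S₀ μ σ r Δt i.val y)
      = price S₀ μ σ r Δt N y - S₀ := by
  rw [Fin.sum_univ_eq_sum_range
    (fun n => price S₀ μ σ r Δt (n + 1) y - price S₀ μ σ r Δt n y),
    Finset.sum_range_sub (fun n => price S₀ μ σ r Δt n y), price_zero]

/-! ### Masses of a mean-zero pair of returns. -/

section Weights

variable {ρ : ℝ → ℝ} {p : ℝ × ℝ}

theorem lossMass_nonneg (ρ : ℝ → ℝ) (p : ℝ × ℝ) : 0 ≤ lossMass ρ p := by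
  unfold lossMass; positivity

theorem gainMass_nonneg (ρ : ℝ → ℝ) (p : ℝ × ℝ) : 0 ≤ gainMass ρ p := by
  unfold gainMass; positivity

theorem lossMass_eq (h₁ : ρ p.1 ≤ 0) (h₂ : 0 < ρ p.2) :
    lossMass ρ p = ρ p.2 / (ρ p.2 - ρ p.1) := by
  unfold lossMass
  rw [max_eq_left h₂.le, max_eq_left (neg_nonneg.2 h₁)]; congr 1; ring

theorem gainMass_eq (h₁ : ρ p.1 ≤ 0) (h₂ : 0 < ρ p.2) :
    gainMass ρ p = -ρ p.1 / (ρ p.2 - ρ p.1) := by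
  unfold gainMass
  rw [max_eq_left h₂.le, max_eq_left (neg_nonneg.2 h₁)]; congr 1; ring

theorem lossMass_add_gainMass (h₁ : ρ p.1 ≤ 0) (h₂ : 0 < ρ p.2) :
    lossMass ρ p + gainMass ρ p = 1 := by
  have : ρ p.2 - ρ p.1 ≠ 0 := by linarith
  rw [lossMass_eq h₁ h₂, gainMass_eq h₁ h₂]; field_simp; ring

theorem lossMass_mul_add_gainMass_mul (h₁ : ρ p.1 ≤ 0) (h₂ : 0 < ρ p.2) :
    lossMass ρ p * ρ p.1 + gainMass ρ p * ρ p.2 = 0 := by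
  have : ρ p.2 - ρ p.1 ≠ 0 := by linarith
  rw [lossMass_eq h₁ h₂, gainMass_eq h₁ h₂]; field_simp; ring

theorem measurable_lossMass (h : Measurable ρ) : Measurable (lossMass ρ) := by
  unfold lossMass
  exact ((h.comp measurable_snd).max measurable_const).div
    (((h.comp measurable_fst).neg.max measurable_const).add
      ((h.comp measurable_snd).max measurable_const))

theorem measurable_gainMass (h : Measurable ρ) : Measurable (gainMass ρ) := by
  unfold gainMass
  exact ((h.comp measurable_fst).neg.max measurable_const).div
    (((h.comp measurable_fst).neg.max measurable_const).add
      ((h.comp measurable_snd).max measurable_const))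

theorem continuousAt_lossMass (h : Continuous ρ) (h₂ : 0 < ρ p.2) :
    ContinuousAt (lossMass ρ) p := by
  unfold lossMass
  have : max (-ρ p.1) 0 + max (ρ p.2) 0 ≠ 0 := by positivity
  fun_prop (disch := assumption)

theorem continuousAt_gainMass (h : Continuous ρ) (h₂ : 0 < ρ p.2) :
    ContinuousAt (gainMass ρ) p := by
  unfold gainMass
  have : max (-ρ p.1) 0 + max (ρ p.2) 0 ≠ 0 := by positivity
  fun_prop (disch := assumption)

end Weights

/-- The probabilities that the pair `(y 0, y 1)` puts on `y 0` and on `y 1`. -/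
noncomputable def pairWeight (ρ : ℝ → ℝ) (y : Fin 2 → ℝ) : Fin 2 → ℝ :=
  ![lossMass ρ (y 0, y 1), gainMass ρ (y 0, y 1)]

theorem pairWeight_nonneg (ρ : ℝ → ℝ) (y : Fin 2 → ℝ) (j : Fin 2) : 0 ≤ pairWeight ρ y j := by
  fin_cases j
  · exact lossMass_nonneg _ _
  · exact gainMass_nonneg _ _

/-- Since `1 + ρ(y) = e^{σ(d+y)}`, each quotient of absolute values is the return at the opposite
point over the difference of the two returns; the signs on the two sides of `-d` resolve the
absolute values. -/
theorem twoPointValue_eq {N : ℕ} {S₀ μ σ r Δt : ℝ} (hσ : 0 < σ) (f : ℝ → ℝ)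
    {y : Fin N → Fin 2 → ℝ} (hy : y ∈ pairFamilies μ σ r Δt N) :
    twoPointValue S₀ μ σ r Δt N f y = ∑ i : Fin N → Fin 2,
      f (S₀ * ∏ s, (1 + rho μ σ r Δt (y s (i s)))) *
        ∏ s, pairWeight (rho μ σ r Δt) (y s) (i s) := by
  unfold twoPointValue
  refine Finset.sum_congr rfl fun i _ => ?_
  congr 1
  refine Finset.prod_congr rfl fun s _ => ?_
  have h₁ := (rho_nonpos_iff hσ μ r Δt _).2 (hy s).1
  have h₂ := (rho_pos_iff hσ μ r Δt _).2 (hy s).2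
  simp only [← one_add_rho hσ.ne']
  generalize i s = j
  fin_cases j
  · simp only [pairWeight, Fin.zero_eta, zero_add, Matrix.cons_val_zero, add_sub_cancel_left,
      add_sub_add_left_eq_sub]
    rw [lossMass_eq h₁ h₂, abs_of_pos h₂, abs_of_pos (by linarith)]
  · simp only [pairWeight, Fin.mk_one, show (1 : Fin 2) + 1 = 0 from rfl, Matrix.cons_val_one,
      Matrix.cons_val_zero, add_sub_cancel_left, add_sub_add_left_eq_sub]
    rw [gainMass_eq h₁ h₂, abs_of_nonpos h₁, abs_of_neg (by linarith), neg_sub]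

/-! ### The supporting line -/

/-- The value at `s` of the chord of `f` over `[a, b]`. -/
noncomputable def chord (f : ℝ → ℝ) (s a b : ℝ) : ℝ :=
  (b - s) / (b - a) * f a + (s - a) / (b - a) * f b

theorem chord_self {f : ℝ → ℝ} {s b : ℝ} (h : s < b) : chord f s s b = f s := by
  have : b - s ≠ 0 := by linarith
  simp [chord, div_self this]

/-- The chord bound says exactly that each slope to a point right of `s` is at most each slope to a
point left of `s`, both taken from height `V` at `s`. Any number separating the two families serves
as `h`. -/
theorem exists_supporting_line {f : ℝ → ℝ} {s V : ℝ} (hs : 0 < s)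
    (hV : ∀ a b, 0 < a → a ≤ s → s < b → chord f s a b ≤ V) :
    ∃ h, ∀ t, 0 < t → f t ≤ V + h * (t - s) := by
  have key : ∀ a b, 0 < a → a < s → s < b → (f b - V) / (b - s) ≤ (V - f a) / (s - a) := by
    intro a b ha has hsb
    have h := hV a b ha has.le hsb
    have e : chord f s a b = ((b - s) * f a + (s - a) * f b) / (b - a) := by
      unfold chord; ring
    rw [e, div_le_iff₀ (by linarith)] at h
    rw [div_le_div_iff₀ (by linarith) (by linarith)]
    nlinarith
  have bdd : BddAbove ((fun b => (f b - V) / (b - s)) '' Set.Ioi s) := by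
    -- Any left slope bounds the right slopes; `s / 2` is merely a positive point left of `s`.
    refine ⟨(V - f (s / 2)) / (s - s / 2), ?_⟩
    rintro _ ⟨b, hb, rfl⟩
    exact key _ _ (by linarith) (by linarith) hb
  refine ⟨sSup ((fun b => (f b - V) / (b - s)) '' Set.Ioi s), fun t ht => ?_⟩
  rcases lt_trichotomy t s with h | h | h
  · have : sSup ((fun b => (f b - V) / (b - s)) '' Set.Ioi s) ≤ (V - f t) / (s - t) := by
      refine csSup_le ⟨_, s + 1, by simp, rfl⟩ ?_
      rintro _ ⟨b, hb, rfl⟩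
      exact key _ _ ht h hb
    rw [le_div_iff₀ (by linarith)] at this
    nlinarith
  -- At `t = s` the degenerate chord with left end `s` gives `f s ≤ V`.
  · subst h
    have := hV t (t + 1) ht le_rfl (by linarith)
    rw [chord_self (by linarith)] at this
    simpa using this
  · have : (f t - V) / (t - s) ≤ sSup ((fun b => (f b - V) / (b - s)) '' Set.Ioi s) :=
      le_csSup bdd ⟨t, h, rfl⟩
    rw [div_le_iff₀ (by linarith)] at this
    linarith

/-! ### Chords and two-point values. -/

theorem chord_eq_pairWeight {S₀ : ℝ} (hS₀ : S₀ ≠ 0) {ρ : ℝ → ℝ} (f : ℝ → ℝ) {p : ℝ × ℝ}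
    (h₁ : ρ p.1 ≤ 0) (h₂ : 0 < ρ p.2) :
    chord f S₀ (S₀ * (1 + ρ p.1)) (S₀ * (1 + ρ p.2))
      = lossMass ρ p * f (S₀ * (1 + ρ p.1)) + gainMass ρ p * f (S₀ * (1 + ρ p.2)) := by
  have : ρ p.2 - ρ p.1 ≠ 0 := by linarith
  rw [lossMass_eq h₁ h₂, gainMass_eq h₁ h₂, chord]
  rw [show S₀ * (1 + ρ p.2) - S₀ = S₀ * ρ p.2 by ring,
    show S₀ - S₀ * (1 + ρ p.1) = S₀ * -ρ p.1 by ring,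
    show S₀ * (1 + ρ p.2) - S₀ * (1 + ρ p.1) = S₀ * (ρ p.2 - ρ p.1) by ring,
    mul_div_mul_left _ _ hS₀, mul_div_mul_left _ _ hS₀]

/-- The product weights form a probability under which the independent factors `1 + ρ` have mean
one, so the terminal price has mean `S₀` and the affine majorant integrates to `V`. -/
theorem twoPointValue_le {N : ℕ} {S₀ μ σ r Δt : ℝ} (hS₀ : 0 < S₀) (hσ : 0 < σ) {f : ℝ → ℝ}
    {V h : ℝ} (hf : ∀ t, 0 < t → f t ≤ V + h * (t - S₀))
    {y : Fin N → Fin 2 → ℝ} (hy : y ∈ pairFamilies μ σ r Δt N) :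
    twoPointValue S₀ μ σ r Δt N f y ≤ V := by
  rw [twoPointValue_eq hσ f hy]
  set w := fun s => pairWeight (rho μ σ r Δt) (y s) with hw
  have h₁ := fun s => (rho_nonpos_iff hσ μ r Δt _).2 (hy s).1
  have h₂ := fun s => (rho_pos_iff hσ μ r Δt _).2 (hy s).2
  have e₁ : ∑ i : Fin N → Fin 2, ∏ s, w s (i s) = 1 := by
    rw [← Fintype.prod_sum]
    refine Finset.prod_eq_one fun s _ => ?_
    rw [Fin.sum_univ_two]
    exact lossMass_add_gainMass (p := (y s 0, y s 1)) (h₁ s) (h₂ s)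
  have e₂ : ∑ i : Fin N → Fin 2, (∏ s, (1 + rho μ σ r Δt (y s (i s)))) * ∏ s, w s (i s) = 1 := by
    simp_rw [← Finset.prod_mul_distrib]
    rw [← Fintype.prod_sum (fun s j => (1 + rho μ σ r Δt (y s j)) * w s j)]
    refine Finset.prod_eq_one fun s _ => ?_
    rw [Fin.sum_univ_two]
    have a₁ := lossMass_add_gainMass (p := (y s 0, y s 1)) (h₁ s) (h₂ s)
    have a₂ := lossMass_mul_add_gainMass_mul (p := (y s 0, y s 1)) (h₁ s) (h₂ s)
    simp only [hw, pairWeight, Matrix.cons_val_zero, Matrix.cons_val_one]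
    linear_combination a₁ + a₂
  calc _ ≤ ∑ i : Fin N → Fin 2, (V + h * (S₀ * ∏ s, (1 + rho μ σ r Δt (y s (i s))) - S₀))
          * ∏ s, w s (i s) := by
        refine Finset.sum_le_sum fun i _ => ?_
        refine mul_le_mul_of_nonneg_right (hf _ ?_)
          (Finset.prod_nonneg fun s _ => pairWeight_nonneg _ _ _)
        exact mul_pos hS₀ (Finset.prod_pos fun s _ => one_add_rho_pos _ _ _ _ _)
    _ = (V - h * S₀) * ∑ i : Fin N → Fin 2, ∏ s, w s (i s) + h * S₀ *
          ∑ i : Fin N → Fin 2, (∏ s, (1 + rho μ σ r Δt (y s (i s)))) * ∏ s, w s (i s) := by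
        rw [Finset.mul_sum, Finset.mul_sum, ← Finset.sum_add_distrib]
        exact Finset.sum_congr rfl fun i _ => by ring
    _ = V := by rw [e₁, e₂]; ring

theorem exists_twoPointValue_eq_chord {N : ℕ} {S₀ μ σ r Δt : ℝ} (hS₀ : 0 < S₀) (hσ : 0 < σ)
    (f : ℝ → ℝ) {a b : ℝ} (ha : 0 < a) (has : a ≤ S₀) (hb : S₀ < b) :
    ∃ y ∈ pairFamilies μ σ r Δt (N + 1),
      twoPointValue S₀ μ σ r Δt (N + 1) f y = chord f S₀ a b := by
  obtain ⟨u, hu⟩ := exists_one_add_rho_eq hσ.ne' μ r Δt (div_pos ha hS₀)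
  obtain ⟨v, hv⟩ := exists_one_add_rho_eq hσ.ne' μ r Δt (div_pos (hS₀.trans hb) hS₀)
  have hu0 : rho μ σ r Δt u ≤ 0 := by
    have := (div_le_one hS₀).2 has; linarith
  have hv0 : 0 < rho μ σ r Δt v := by
    have := (one_lt_div hS₀).2 hb; linarith
  have hz : rho μ σ r Δt (-shift μ σ r Δt) = 0 := by simp [rho_eq hσ.ne']
  set y : Fin (N + 1) → Fin 2 → ℝ :=
    -- The later pairs have left point exactly `-d`, which the non-strict inequality permits; it
    -- receives mass one. The right point is arbitrary.
    Fin.cons ![u, v] fun _ => ![-shift μ σ r Δt, -shift μ σ r Δt + 1] with hy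
  have hmem : y ∈ pairFamilies μ σ r Δt (N + 1) := by
    intro s
    refine Fin.cases ?_ (fun s => ?_) s
    · simpa [hy] using ⟨(rho_nonpos_iff hσ _ _ _ _).1 hu0, (rho_pos_iff hσ _ _ _ _).1 hv0⟩
    · simp [hy]
  refine ⟨y, hmem, ?_⟩
  have hp := (rho_pos_iff hσ μ r Δt (-shift μ σ r Δt + 1)).2 (by linarith)
  have w0 : ∀ s : Fin N, pairWeight (rho μ σ r Δt) (y s.succ) 0 = 1 := fun s => by
    simp only [hy, pairWeight, Fin.cons_succ, Matrix.cons_val_zero, Matrix.cons_val_one]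
    rw [lossMass_eq (by simp [hz]) (by simpa using hp)]
    simp [hz, hp.ne']
  have w1 : ∀ s : Fin N, pairWeight (rho μ σ r Δt) (y s.succ) 1 = 0 := fun s => by
    simp only [hy, pairWeight, Fin.cons_succ, Matrix.cons_val_zero, Matrix.cons_val_one]
    rw [gainMass_eq (by simp [hz]) (by simpa using hp)]
    simp [hz]
  rw [twoPointValue_eq hσ f hmem,
    -- An index choosing the right point in some later pair has weight zero, so only the two choices
    -- in the first pair survive.
    Fintype.sum_eq_add (Fin.cons 0 fun _ => 0) (Fin.cons 1 fun _ => 0)]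
  · rw [show a = S₀ * (1 + rho μ σ r Δt u) by rw [hu]; field_simp,
      show b = S₀ * (1 + rho μ σ r Δt v) by rw [hv]; field_simp,
      chord_eq_pairWeight hS₀.ne' (p := (u, v)) f hu0 hv0]
    simp only [Fin.prod_univ_succ, Fin.cons_zero, Fin.cons_succ, w0]
    simp [hy, hz, pairWeight]
    ring
  · intro h
    simpa using congrFun h 0
  · rintro i ⟨h0, h1⟩
    obtain ⟨s, hs⟩ : ∃ s : Fin N, i s.succ = 1 := by
      by_contra! hne
      have hi : ∀ s : Fin N, i s.succ = 0 := fun s => by have := hne s; omega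
      rcases (by omega : i 0 = 0 ∨ i 0 = 1) with h | h
      · exact h0 (funext fun s => by refine Fin.cases ?_ (fun s => ?_) s <;> simp [h, hi])
      · exact h1 (funext fun s => by refine Fin.cases ?_ (fun s => ?_) s <;> simp [h, hi])
    refine mul_eq_zero_of_right _ (Finset.prod_eq_zero (Finset.mem_univ s.succ) ?_)
    rw [hs, w1]

/-! ### Finite products of measures -/

section Pi

theorem measurable_cons {N : ℕ} : Measurable fun z : ℝ × Path N => (Fin.cons z.1 z.2 : Path (N + 1)) := by
  refine measurable_pi_iff.2 fun i => ?_
  refine Fin.cases ?_ (fun i => ?_) i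
  · simpa using measurable_fst
  · simpa [Function.comp_def] using (measurable_pi_apply i).comp measurable_snd

theorem measurableEmbedding_cons {N : ℕ} :
    MeasurableEmbedding fun z : ℝ × Path N => (Fin.cons z.1 z.2 : Path (N + 1)) := by
  have := (MeasurableEquiv.piFinSuccAbove (fun _ : Fin (N + 1) => ℝ) 0).symm.measurableEmbedding
  convert this using 1
  ext z : 1
  simp [MeasurableEquiv.piFinSuccAbove, Fin.insertNthEquiv]

theorem measurePreserving_cons {N : ℕ} (q : Fin (N + 1) → Measure ℝ) [∀ i, SigmaFinite (q i)] :
    MeasurePreserving (fun z : ℝ × Path N => (Fin.cons z.1 z.2 : Path (N + 1)))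
      ((q 0).prod (Measure.pi fun i => q i.succ)) (Measure.pi q) := by
  have := (measurePreserving_piFinSuccAbove q 0).symm
  convert this using 1
  · ext z : 1
    simp [MeasurableEquiv.piFinSuccAbove, Fin.insertNthEquiv]
  · simp only [Fin.succAbove_zero]

theorem pi_absolutelyContinuous {N : ℕ} {q p : Fin N → Measure ℝ} [∀ i, SigmaFinite (q i)]
    [∀ i, SigmaFinite (p i)] (h : ∀ i, q i ≪ p i) : Measure.pi q ≪ Measure.pi p := by
  induction N with
  | zero => rw [Subsingleton.elim q p]
  | succ N ih =>
    rw [← (measurePreserving_cons q).map_eq, ← (measurePreserving_cons p).map_eq]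
    exact ((h 0).prod (ih fun i => h i.succ)).map measurable_cons

/-- The product measure is linear in each factor; this permits perturbing one coordinate at a time.
-/
theorem pi_update_combination {N : ℕ} (q : Fin N → Measure ℝ) [∀ i, IsFiniteMeasure (q i)]
    (j : Fin N) (A B : Measure ℝ) [IsFiniteMeasure A] [IsFiniteMeasure B] (a b : ℝ≥0) :
    Measure.pi (Function.update q j (a • A + b • B))
      = a • Measure.pi (Function.update q j A) + b • Measure.pi (Function.update q j B) := by
  have inst : ∀ M : Measure ℝ, IsFiniteMeasure M → ∀ i, IsFiniteMeasure (Function.update q j M i) := by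
    intro M hM i
    rcases eq_or_ne i j with rfl | h
    · simpa using hM
    · rw [Function.update_of_ne h]; infer_instance
  have := inst A inferInstance
  have := inst B inferInstance
  have := inst (a • A + b • B) inferInstance
  refine Measure.pi_eq fun s hs => ?_
  have e : ∀ M : Measure ℝ, ∏ i, Function.update q j M i (s i)
      = M (s j) * ∏ i ∈ Finset.univ \ {j}, q i (s i) := fun M => by
    rw [← Finset.prod_sdiff (Finset.subset_univ {j}), mul_comm]
    congr 1
    · simp
    · refine Finset.prod_congr rfl fun i hi => ?_
      rw [Function.update_of_ne (by simpa using hi)]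
  simp only [Measure.add_apply, Measure.smul_apply, Measure.pi_pi, e]
  simp only [ENNReal.smul_def, smul_eq_mul]
  ring

end Pi

/-! ### Weak duality -/

/-- Conditioning on the first coordinate `u` turns the claim into that for the remaining steps with
capital `x + K 0 * ρ u`. As `K 0` is then a constant, only `F` and `ρ` are ever integrated, so no
integrability of the strategy is required. -/
theorem integral_le_of_superhedge {N : ℕ} {ρ : ℝ → ℝ} {q : Fin N → Measure ℝ}
    [∀ i, IsProbabilityMeasure (q i)] (hρ : ∀ i, Integrable ρ (q i)) (hρ0 : ∀ i, ∫ u, ρ u ∂q i = 0)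
    {F : Path N → ℝ} (hF : Integrable F (Measure.pi q)) {x : ℝ} {K : Fin N → Path N → ℝ}
    (hK : ∀ i y z, (∀ j : Fin N, j < i → y j = z j) → K i y = K i z)
    (h : ∀ᵐ y ∂Measure.pi q, F y ≤ x + ∑ i, K i y * ρ (y i)) :
    ∫ y, F y ∂Measure.pi q ≤ x := by
  induction N generalizing x with
  | zero =>
    have := integral_mono_ae hF (integrable_const x) (h.mono fun y hy => by simpa using hy)
    simpa using this
  | succ N ih =>
    have mp := measurePreserving_cons q
    have hF' : Integrable (fun z : ℝ × Path N => F (Fin.cons z.1 z.2))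
      ((q 0).prod (Measure.pi fun i => q i.succ)) := mp.integrable_comp_of_integrable hF
    rw [← mp.integral_comp measurableEmbedding_cons, integral_prod _ hF']
    have h' := Measure.ae_ae_of_ae_prod (mp.quasiMeasurePreserving.ae h)
    have hbound : ∀ᵐ u ∂q 0, ∫ y, F (Fin.cons u y) ∂(Measure.pi fun i => q i.succ)
        ≤ x + K 0 0 * ρ u := by
      filter_upwards [h', hF'.prod_right_ae] with u hu hFu
      refine ih (fun i => hρ i.succ) (fun i => hρ0 i.succ) hFu
        (K := fun i y => K i.succ (Fin.cons u y)) ?_ ?_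
      · intro i y z hyz
        refine hK _ _ _ fun j hj => ?_
        induction j using Fin.cases with
        | zero => simp
        | succ j => simpa using hyz j (Fin.succ_lt_succ_iff.1 hj)
      · filter_upwards [hu] with y hy
        -- The first position sees no coordinate, so it may be evaluated at the zero path.
        rw [Fin.sum_univ_succ, hK 0 _ 0 (fun j hj => absurd hj (Fin.not_lt_zero j))] at hy
        simpa [add_assoc] using hy
    calc _ ≤ ∫ u, (x + K 0 0 * ρ u) ∂q 0 :=
          integral_mono_ae hF'.integral_prod_left
            ((integrable_const x).add ((hρ 0).const_mul _)) hbound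
      _ = x := by
          rw [integral_add (integrable_const x) ((hρ 0).const_mul _), integral_const_mul, hρ0]
          simp

/-- The σ-algebra is contained in the one pulled back along the restriction `R` to the first `n`
coordinates, so the level set of `g` through `y` is a union of fibres of `R`. -/
theorem eq_of_measurable_coordSigma {N n : ℕ} {g : Path N → ℝ} (hg : Measurable[coordSigma N n] g)
    {y z : Path N} (hyz : ∀ j : Fin N, j.val < n → y j = z j) : g y = g z := by
  let R : Path N → {j : Fin N // j.val < n} → ℝ := fun y j => y j.1
  have hle : coordSigma N n ≤ MeasurableSpace.comap R inferInstance := by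
    refine iSup₂_le fun i hi => ?_
    rw [← measurable_iff_comap_le]
    exact (measurable_pi_apply (⟨i, hi⟩ : {j : Fin N // j.val < n})).comp (comap_measurable R)
  obtain ⟨s, -, hs⟩ := hle _ (hg (measurableSet_singleton (g y)))
  have hy : y ∈ g ⁻¹' {g y} := rfl
  rw [← hs] at hy
  have hz : z ∈ g ⁻¹' {g y} := by
    rw [← hs]
    have e : R y = R z := funext fun j => hyz j.1 j.2
    rwa [Set.mem_preimage, ← e]
  exact (Set.mem_singleton_iff.1 hz).symm

theorem price_congr {N n : ℕ} (S₀ μ σ r Δt : ℝ) {y z : Path N}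
    (hyz : ∀ j : Fin N, j.val < n → y j = z j) :
    price S₀ μ σ r Δt n y = price S₀ μ σ r Δt n z := by
  unfold price zeta
  rw [Finset.sum_congr rfl fun i hi => hyz i (Finset.mem_filter.1 hi).2]

theorem integral_le_of_mem_superHedgeCapitals {N : ℕ} {S₀ μ σ r Δt : ℝ} {f : ℝ → ℝ} {x : ℝ}
    (hx : x ∈ superHedgeCapitals S₀ μ σ r Δt N f) {q : Fin N → Measure ℝ}
    [∀ i, IsProbabilityMeasure (q i)] (hq : ∀ i, q i ≪ stepLaw Δt)
    (hρ : ∀ i, Integrable (rho μ σ r Δt) (q i)) (hρ0 : ∀ i, ∫ u, rho μ σ r Δt u ∂q i = 0)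
    (hf : Integrable (fun y => f (price S₀ μ σ r Δt N y)) (Measure.pi q)) :
    ∫ y, f (price S₀ μ σ r Δt N y) ∂Measure.pi q ≤ x := by
  obtain ⟨H, hH, hle⟩ := hx
  have : IsProbabilityMeasure (stepLaw Δt) := by unfold stepLaw; infer_instance
  refine integral_le_of_superhedge hρ hρ0 hf
    (K := fun i y => H i y * price S₀ μ σ r Δt i.val y) ?_ ?_
  · intro i y z hyz
    rw [price_congr S₀ μ σ r Δt (y := y) (z := z) hyz, eq_of_measurable_coordSigma (hH i) hyz]
  · filter_upwards [(pi_absolutelyContinuous hq).ae_le hle] with y hy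
    simpa only [price_succ_sub, mul_assoc] using hy

/-! ### Mixtures of two-point measures -/

/-- The mixture, with mixing measure `m`, of the two-point measures of mean zero return carried by
the pairs `(y₁, y₂)`. -/
noncomputable def twoPointMixture (ρ : ℝ → ℝ) (m : Measure (ℝ × ℝ)) : Measure ℝ :=
  (m.withDensity fun p => ENNReal.ofReal (lossMass ρ p)).map Prod.fst +
    (m.withDensity fun p => ENNReal.ofReal (gainMass ρ p)).map Prod.snd

section Mixture

variable {ρ : ℝ → ℝ}

theorem measurable_ofReal_lossMass (hρ : Measurable ρ) :
    Measurable fun p => ENNReal.ofReal (lossMass ρ p) := (measurable_lossMass hρ).ennreal_ofReal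

theorem measurable_ofReal_gainMass (hρ : Measurable ρ) :
    Measurable fun p => ENNReal.ofReal (gainMass ρ p) := (measurable_gainMass hρ).ennreal_ofReal

theorem lintegral_twoPointMixture (hρ : Measurable ρ) (m : Measure (ℝ × ℝ)) {h : ℝ → ℝ≥0∞}
    (hh : Measurable h) : ∫⁻ u, h u ∂twoPointMixture ρ m
      = ∫⁻ p, (ENNReal.ofReal (lossMass ρ p) * h p.1 + ENNReal.ofReal (gainMass ρ p) * h p.2) ∂m := by
  have h1 := measurable_ofReal_lossMass hρ
  have h2 := measurable_ofReal_gainMass hρ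
  have i1 : Measurable fun p : ℝ × ℝ => h p.1 := hh.comp measurable_fst
  have i2 : Measurable fun p : ℝ × ℝ => h p.2 := hh.comp measurable_snd
  rw [twoPointMixture, lintegral_add_measure, lintegral_map hh measurable_fst,
    lintegral_map hh measurable_snd, lintegral_withDensity_eq_lintegral_mul _ h1 i1,
    lintegral_withDensity_eq_lintegral_mul _ h2 i2, ← lintegral_add_left (h1.mul i1)]
  rfl

theorem twoPointMixture_apply (hρ : Measurable ρ) (m : Measure (ℝ × ℝ)) {A : Set ℝ}
    (hA : MeasurableSet A) : twoPointMixture ρ m A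
      = ∫⁻ p, (ENNReal.ofReal (lossMass ρ p) * A.indicator 1 p.1
        + ENNReal.ofReal (gainMass ρ p) * A.indicator 1 p.2) ∂m := by
  rw [← lintegral_twoPointMixture hρ m (measurable_one.indicator hA), lintegral_indicator_one hA]

theorem twoPointMixture_combination (hρ : Measurable ρ) (m n : Measure (ℝ × ℝ)) (a b : ℝ≥0) :
    twoPointMixture ρ (a • m + b • n) = a • twoPointMixture ρ m + b • twoPointMixture ρ n := by
  ext A hA
  simp only [Measure.add_apply, Measure.smul_apply, twoPointMixture_apply hρ _ hA,
    lintegral_add_measure, lintegral_smul_measure]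

theorem twoPointMixture_absolutelyContinuous {P : Measure ℝ} [SFinite P]
    {m : Measure (ℝ × ℝ)} (hm : m ≪ P.prod P) : twoPointMixture ρ m ≪ P := by
  refine Measure.AbsolutelyContinuous.add_left_iff.2 ⟨?_, ?_⟩
  · exact (((withDensity_absolutelyContinuous _ _).trans hm).map measurable_fst).trans
      Measure.quasiMeasurePreserving_fst.absolutelyContinuous
  · exact (((withDensity_absolutelyContinuous _ _).trans hm).map measurable_snd).trans
      Measure.quasiMeasurePreserving_snd.absolutelyContinuous

theorem isProbabilityMeasure_twoPointMixture (hρ : Measurable ρ) {m : Measure (ℝ × ℝ)}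
    [IsProbabilityMeasure m] (hm : ∀ᵐ p ∂m, ρ p.1 ≤ 0 ∧ 0 < ρ p.2) :
    IsProbabilityMeasure (twoPointMixture ρ m) := by
  refine ⟨?_⟩
  rw [twoPointMixture_apply hρ _ .univ, lintegral_congr_ae (g := fun _ => 1)]
  · simp
  · filter_upwards [hm] with p hp
    simp only [Set.indicator_univ, Pi.one_apply, mul_one]
    rw [← ENNReal.ofReal_add (lossMass_nonneg _ _) (gainMass_nonneg _ _),
      lossMass_add_gainMass hp.1 hp.2, ENNReal.ofReal_one]

/-- Each pair gives `1 + ρ` mean one. Since `1 + ρ ≥ 0`, this can be computed with the lower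
integral, which yields integrability at the same time. -/
theorem hasMeanZero_twoPointMixture (hρ : Measurable ρ) (hρ1 : ∀ u, 0 ≤ 1 + ρ u)
    {m : Measure (ℝ × ℝ)} [IsProbabilityMeasure m] (hm : ∀ᵐ p ∂m, ρ p.1 ≤ 0 ∧ 0 < ρ p.2) :
    Integrable ρ (twoPointMixture ρ m) ∧ ∫ u, ρ u ∂twoPointMixture ρ m = 0 := by
  have := isProbabilityMeasure_twoPointMixture hρ hm
  have e : ∫⁻ u, ENNReal.ofReal (1 + ρ u) ∂twoPointMixture ρ m = 1 := by
    rw [lintegral_twoPointMixture hρ _ (hρ.const_add 1).ennreal_ofReal,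
      lintegral_congr_ae (g := fun _ => 1)]
    · simp
    · filter_upwards [hm] with p hp
      rw [← ENNReal.ofReal_mul (lossMass_nonneg _ _), ← ENNReal.ofReal_mul (gainMass_nonneg _ _),
        ← ENNReal.ofReal_add (mul_nonneg (lossMass_nonneg _ _) (hρ1 _))
          (mul_nonneg (gainMass_nonneg _ _) (hρ1 _)), ← ENNReal.ofReal_one]
      congr 1
      linear_combination lossMass_add_gainMass hp.1 hp.2
        + lossMass_mul_add_gainMass_mul hp.1 hp.2
  have hint : Integrable (fun u => 1 + ρ u) (twoPointMixture ρ m) := by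
    refine ⟨(hρ.const_add 1).aestronglyMeasurable, ?_⟩
    rw [hasFiniteIntegral_iff_ofReal (.of_forall hρ1), e]
    exact ENNReal.one_lt_top
  have hi : Integrable ρ (twoPointMixture ρ m) := by
    refine (hint.sub (integrable_const (1 : ℝ))).congr (.of_forall fun u => ?_)
    simp
  refine ⟨hi, ?_⟩
  have : ∫ u, (1 + ρ u) ∂twoPointMixture ρ m = 1 := by
    rw [integral_eq_lintegral_of_nonneg_ae (.of_forall hρ1)
      (hρ.const_add 1).aestronglyMeasurable, e, ENNReal.toReal_one]
  rw [integral_add (integrable_const _) hi] at this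
  simpa using this

theorem integrable_twoPointMixture (hρ : Measurable ρ) {m : Measure (ℝ × ℝ)} {g : ℝ → ℝ}
    (hgm : Measurable g) (hg : Integrable g (twoPointMixture ρ m)) :
    Integrable (fun p => lossMass ρ p * g p.1) m ∧
      Integrable (fun p => gainMass ρ p * g p.2) m := by
  obtain ⟨i1, i2⟩ := integrable_add_measure.1 hg
  have j1 := (integrable_map_measure hgm.aestronglyMeasurable measurable_fst.aemeasurable).1 i1
  have j2 := (integrable_map_measure hgm.aestronglyMeasurable measurable_snd.aemeasurable).1 i2
  rw [integrable_withDensity_iff_integrable_smul' (measurable_ofReal_lossMass hρ) (by simp)] at j1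
  rw [integrable_withDensity_iff_integrable_smul' (measurable_ofReal_gainMass hρ) (by simp)] at j2
  simp only [ENNReal.toReal_ofReal (lossMass_nonneg _ _), smul_eq_mul,
    Function.comp_apply] at j1
  simp only [ENNReal.toReal_ofReal (gainMass_nonneg _ _), smul_eq_mul,
    Function.comp_apply] at j2
  exact ⟨j1, j2⟩

theorem integral_twoPointMixture (hρ : Measurable ρ) {m : Measure (ℝ × ℝ)} {g : ℝ → ℝ}
    (hgm : Measurable g) (hg : Integrable g (twoPointMixture ρ m)) :
    ∫ u, g u ∂twoPointMixture ρ m = ∫ p, (lossMass ρ p * g p.1 + gainMass ρ p * g p.2) ∂m := by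
  obtain ⟨i1, i2⟩ := integrable_add_measure.1 hg
  obtain ⟨j1, j2⟩ := integrable_twoPointMixture hρ hgm hg
  rw [twoPointMixture, integral_add_measure i1 i2, integral_add j1 j2,
    integral_map measurable_fst.aemeasurable hgm.aestronglyMeasurable,
    integral_map measurable_snd.aemeasurable hgm.aestronglyMeasurable,
    integral_withDensity_eq_integral_toReal_smul (measurable_ofReal_lossMass hρ) (by simp),
    integral_withDensity_eq_integral_toReal_smul (measurable_ofReal_gainMass hρ) (by simp)]
  simp only [ENNReal.toReal_ofReal (lossMass_nonneg _ _),
    ENNReal.toReal_ofReal (gainMass_nonneg _ _), smul_eq_mul]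

end Mixture

section OneStep

variable {P : Measure ℝ} {ρ : ℝ → ℝ}

theorem measurableSet_lossSet (hρ : Measurable ρ) : MeasurableSet (lossSet ρ) :=
  measurableSet_le hρ measurable_const

theorem measurableSet_gainSet (hρ : Measurable ρ) : MeasurableSet (gainSet ρ) :=
  measurableSet_lt measurable_const hρ

theorem pairLaw_eq_restrict [SFinite P] :
    pairLaw P ρ = (P.prod P).restrict (lossSet ρ ×ˢ gainSet ρ) := Measure.prod_restrict _ _

theorem pairLaw_absolutelyContinuous [SFinite P] : pairLaw P ρ ≪ P.prod P := by
  rw [pairLaw_eq_restrict]; exact Measure.restrict_le_self.absolutelyContinuous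

theorem ae_pairLaw [SFinite P] (hρ : Measurable ρ) :
    ∀ᵐ p ∂pairLaw P ρ, ρ p.1 ≤ 0 ∧ 0 < ρ p.2 := by
  rw [pairLaw_eq_restrict]
  exact ae_restrict_mem ((measurableSet_lossSet hρ).prod (measurableSet_gainSet hρ))

theorem pairLaw_univ [SFinite P] : pairLaw P ρ Set.univ = P (lossSet ρ) * P (gainSet ρ) := by
  rw [pairLaw, ← Set.univ_prod_univ, Measure.prod_prod]; simp

instance [IsFiniteMeasure P] : IsFiniteMeasure (pairLaw P ρ) := by
  unfold pairLaw; infer_instance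

theorem isProbabilityMeasure_withDensity {α : ℝ × ℝ → ℝ≥0} (h : IsMixingDensity P ρ α) :
    IsProbabilityMeasure ((pairLaw P ρ).withDensity fun p => (α p : ℝ≥0∞)) :=
  ⟨by rw [withDensity_apply _ .univ, setLIntegral_univ, h.total]⟩

theorem mem_oneStepMeasures_iff (hρ : Measurable ρ) {Q : Measure ℝ} :
    Q ∈ oneStepMeasures P ρ ↔ ∃ α : ℝ × ℝ → ℝ≥0, IsMixingDensity P ρ α ∧
      Q = twoPointMixture ρ ((pairLaw P ρ).withDensity fun p => (α p : ℝ≥0∞)) := by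
  refine exists_congr fun α => and_congr_right fun hα => ?_
  have h0 := hα.measurable.coe_nnreal_ennreal
  have key : ∀ A : Set ℝ, MeasurableSet A →
      twoPointMixture ρ ((pairLaw P ρ).withDensity fun p => (α p : ℝ≥0∞)) A
        = ∫⁻ p, A.indicator 1 p.1 * α p * ENNReal.ofReal (lossMass ρ p) ∂(pairLaw P ρ)
        + ∫⁻ p, A.indicator 1 p.2 * α p * ENNReal.ofReal (gainMass ρ p) ∂(pairLaw P ρ) := by
    intro A hA
    have i1 : Measurable fun p : ℝ × ℝ => A.indicator (1 : ℝ → ℝ≥0∞) p.1 :=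
      (measurable_one.indicator hA).comp measurable_fst
    have i2 : Measurable fun p : ℝ × ℝ => A.indicator (1 : ℝ → ℝ≥0∞) p.2 :=
      (measurable_one.indicator hA).comp measurable_snd
    have h1 := measurable_ofReal_lossMass hρ
    have h2 := measurable_ofReal_gainMass hρ
    rw [twoPointMixture_apply hρ _ hA, lintegral_withDensity_eq_lintegral_mul _ h0
      (g := fun p => ENNReal.ofReal (lossMass ρ p) * A.indicator 1 p.1
        + ENNReal.ofReal (gainMass ρ p) * A.indicator 1 p.2) ((h1.mul i1).add (h2.mul i2)), ← lintegral_add_left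
      (f := fun p => A.indicator 1 p.1 * α p * ENNReal.ofReal (lossMass ρ p))
      ((i1.mul h0).mul h1)]
    refine lintegral_congr fun p => ?_
    simp only [Pi.mul_apply]
    ring
  constructor
  · intro h
    ext A hA
    rw [h A hA, key A hA]
  · rintro rfl A hA
    exact key A hA

/-- A mixing measure above a positive multiple of the pair law has a density bounded below. The
integrability condition on `α` is automatic, because `ρ⁻ ≤ 1`. -/
theorem twoPointMixture_mem_oneStepMeasures [IsFiniteMeasure P] (hρ : Measurable ρ)
    (hρ1 : ∀ u, 0 ≤ 1 + ρ u) {m : Measure (ℝ × ℝ)} [IsProbabilityMeasure m]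
    (hm : m ≪ pairLaw P ρ) {c : ℝ≥0} (hc : 0 < c) (hle : c • pairLaw P ρ ≤ m) :
    twoPointMixture ρ m ∈ oneStepMeasures P ρ := by
  set ν := pairLaw P ρ with hν
  -- Almost everywhere the maximum is the density itself; taking it makes `α` positive at every
  -- point.
  let α : ℝ × ℝ → ℝ≥0 := fun p => max c (m.rnDeriv ν p).toNNReal
  have hαm : Measurable α := measurable_const.max (Measure.measurable_rnDeriv m ν).ennreal_toNNReal
  have hαe : (fun p => (α p : ℝ≥0∞)) =ᵐ[ν] m.rnDeriv ν := by
    have h1 : (fun _ => (c : ℝ≥0∞)) ≤ᵐ[ν] m.rnDeriv ν := by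
      refine ae_le_of_forall_setLIntegral_le_of_sigmaFinite measurable_const fun s hs _ => ?_
      rw [Measure.setLIntegral_rnDeriv hm]
      simpa using hle s
    filter_upwards [h1, Measure.rnDeriv_lt_top m ν] with p h1 h2
    simp only [α]
    rw [ENNReal.coe_max, ENNReal.coe_toNNReal h2.ne, max_eq_right h1]
  have hmα : ν.withDensity (fun p => (α p : ℝ≥0∞)) = m := by
    rw [withDensity_congr_ae hαe, Measure.withDensity_rnDeriv_eq _ _ hm]
  have htot : ∫⁻ p, α p ∂ν = 1 := by
    rw [← setLIntegral_univ, ← withDensity_apply _ .univ, hmα, measure_univ]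
  refine (mem_oneStepMeasures_iff hρ).2 ⟨α, ⟨hαm, ?_, ?_, htot⟩, by rw [← hν, hmα]⟩
  · rw [show {p | 0 < α p} = Set.univ from
      Set.eq_univ_of_forall fun p => lt_max_of_lt_left hc, pairLaw_univ, mul_comm]
  · refine lt_of_le_of_lt (lintegral_mono fun p => ?_) (htot.trans_lt ENNReal.one_lt_top)
    refine mul_le_of_le_one_right' (ENNReal.ofReal_le_one.2 (div_le_one_of_le₀ ?_ (by positivity)))
    have h1 : max (-ρ p.1) 0 ≤ 1 := max_le (by linarith [hρ1 p.1]) zero_le_one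
    have h2 : 0 ≤ max (-ρ p.1) 0 := le_max_right _ _
    have h3 : 0 ≤ max (ρ p.2) 0 := le_max_right _ _
    nlinarith

end OneStep

/-! ### Mixing densities that may vanish -/

section Relaxed

variable {P : Measure ℝ} {ρ : ℝ → ℝ}

/-- The variant of `oneStepMeasures` in which the mixing measure need not be equivalent to
`pairLaw P ρ`. -/
def relaxedMeasures (P : Measure ℝ) (ρ : ℝ → ℝ) : Set (Measure ℝ) :=
  {Q | ∃ m : Measure (ℝ × ℝ), IsProbabilityMeasure m ∧ m ≪ pairLaw P ρ ∧ Q = twoPointMixture ρ m}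

/-- The normalised pair law. -/
noncomputable def pairProb (P : Measure ℝ) (ρ : ℝ → ℝ) : Measure (ℝ × ℝ) :=
  (pairLaw P ρ Set.univ).toNNReal⁻¹ • pairLaw P ρ

theorem pairLaw_univ_ne_zero [SFinite P] (hl : P (lossSet ρ) ≠ 0) (hg : P (gainSet ρ) ≠ 0) :
    pairLaw P ρ Set.univ ≠ 0 := by
  rw [pairLaw_univ]; exact mul_ne_zero hl hg

theorem isProbabilityMeasure_pairProb [IsFiniteMeasure P] (hl : P (lossSet ρ) ≠ 0)
    (hg : P (gainSet ρ) ≠ 0) : IsProbabilityMeasure (pairProb P ρ) := by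
  have h0 := pairLaw_univ_ne_zero hl hg
  have h1 : (pairLaw P ρ Set.univ).toNNReal ≠ 0 := by
    simp [ENNReal.toNNReal_eq_zero_iff, h0]
  refine ⟨?_⟩
  rw [pairProb, Measure.smul_apply, ENNReal.smul_def, smul_eq_mul, ENNReal.coe_inv h1,
    ENNReal.coe_toNNReal (measure_ne_top _ _), ENNReal.inv_mul_cancel h0 (measure_ne_top _ _)]

theorem oneStepMeasures_subset_relaxedMeasures (hρ : Measurable ρ) :
    oneStepMeasures P ρ ⊆ relaxedMeasures P ρ := by
  intro Q hQ
  obtain ⟨α, hα, rfl⟩ := (mem_oneStepMeasures_iff hρ).1 hQ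
  exact ⟨_, isProbabilityMeasure_withDensity hα, withDensity_absolutelyContinuous _ _, rfl⟩

theorem isProbabilityMeasure_of_mem_relaxedMeasures [SFinite P] (hρ : Measurable ρ) {Q : Measure ℝ}
    (hQ : Q ∈ relaxedMeasures P ρ) : IsProbabilityMeasure Q := by
  obtain ⟨m, hm, hac, rfl⟩ := hQ
  exact isProbabilityMeasure_twoPointMixture hρ (hac.ae_le (ae_pairLaw hρ))

theorem hasMeanZero_of_mem_relaxedMeasures [SFinite P] (hρ : Measurable ρ)
    (hρ1 : ∀ u, 0 ≤ 1 + ρ u) {Q : Measure ℝ} (hQ : Q ∈ relaxedMeasures P ρ) :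
    Integrable ρ Q ∧ ∫ u, ρ u ∂Q = 0 := by
  obtain ⟨m, hm, hac, rfl⟩ := hQ
  exact hasMeanZero_twoPointMixture hρ hρ1 (hac.ae_le (ae_pairLaw hρ))

theorem absolutelyContinuous_of_mem_relaxedMeasures [SFinite P] {Q : Measure ℝ}
    (hQ : Q ∈ relaxedMeasures P ρ) : Q ≪ P := by
  obtain ⟨m, hm, hac, rfl⟩ := hQ
  exact twoPointMixture_absolutelyContinuous (hac.trans pairLaw_absolutelyContinuous)

/-- The share `b` of the normalised pair law bounds the mixing measure below by a positive multiple
of the pair law. -/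
theorem combination_mem_oneStepMeasures [IsFiniteMeasure P] (hρ : Measurable ρ)
    (hρ1 : ∀ u, 0 ≤ 1 + ρ u) (hl : P (lossSet ρ) ≠ 0) (hg : P (gainSet ρ) ≠ 0) {Q : Measure ℝ}
    (hQ : Q ∈ relaxedMeasures P ρ) {a b : ℝ≥0} (hb : 0 < b) (hab : a + b = 1) :
    a • Q + b • twoPointMixture ρ (pairProb P ρ) ∈ oneStepMeasures P ρ := by
  obtain ⟨m, hm, hac, rfl⟩ := hQ
  have := isProbabilityMeasure_pairProb hl hg
  have hpac : pairProb P ρ ≪ pairLaw P ρ := Measure.smul_absolutelyContinuous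
  rw [← twoPointMixture_combination hρ]
  have : IsProbabilityMeasure (a • m + b • pairProb P ρ) := by
    refine ⟨?_⟩
    simp only [Measure.add_apply, Measure.smul_apply, measure_univ, ENNReal.smul_def, smul_eq_mul,
      mul_one]
    exact_mod_cast hab
  have hc : 0 < b * (pairLaw P ρ Set.univ).toNNReal⁻¹ := by
    refine mul_pos hb (inv_pos.2 (ENNReal.toNNReal_pos (pairLaw_univ_ne_zero hl hg)
      (measure_ne_top _ _)))
  refine twoPointMixture_mem_oneStepMeasures hρ hρ1 ?_ hc ?_
  · exact Measure.AbsolutelyContinuous.add_left_iff.2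
      ⟨Measure.smul_absolutelyContinuous.trans hac, Measure.smul_absolutelyContinuous.trans hpac⟩
  · rw [mul_smul]
    exact Measure.le_add_left le_rfl

theorem twoPointMixture_pairProb_mem [IsFiniteMeasure P] (hρ : Measurable ρ)
    (hρ1 : ∀ u, 0 ≤ 1 + ρ u) (hl : P (lossSet ρ) ≠ 0) (hg : P (gainSet ρ) ≠ 0) :
    twoPointMixture ρ (pairProb P ρ) ∈ oneStepMeasures P ρ := by
  have h : twoPointMixture ρ (pairProb P ρ) ∈ relaxedMeasures P ρ :=
    ⟨_, isProbabilityMeasure_pairProb hl hg, Measure.smul_absolutelyContinuous, rfl⟩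
  simpa using combination_mem_oneStepMeasures hρ hρ1 hl hg h one_pos (zero_add 1)

theorem integrable_of_smul_nnreal {α : Type*} [MeasurableSpace α] {m : Measure α} {F : α → ℝ}
    {c : ℝ≥0} (hc : c ≠ 0) (h : Integrable F (c • m)) : Integrable F m := by
  have := h.smul_measure_nnreal (c := c⁻¹)
  rwa [smul_smul, inv_mul_cancel₀ hc, one_smul] at this

theorem le_of_forall_combination_le {x y w : ℝ}
    (h : ∀ ε : ℝ, 0 < ε → ε < 1 → (1 - ε) * x + ε * y ≤ w) : x ≤ w := by
  have ht : Filter.Tendsto (fun ε : ℝ => (1 - ε) * x + ε * y) (𝓝[>] 0) (𝓝 x) := by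
    have : Continuous fun ε : ℝ => (1 - ε) * x + ε * y := by fun_prop
    simpa using this.continuousWithinAt (s := Set.Ioi 0) (x := 0) |>.tendsto
  refine le_of_tendsto ht ?_
  filter_upwards [Ioo_mem_nhdsGT one_pos] with ε hε
  exact h ε hε.1 hε.2

/-- Passing to densities that may vanish does not raise the bound: each relaxed factor is a limit of
admissible ones, obtained by adding a share `ε` of a fixed admissible measure and letting `ε → 0`.
-/
theorem integral_le_of_relaxed [IsFiniteMeasure P] (hρ : Measurable ρ)
    (hρ1 : ∀ u, 0 ≤ 1 + ρ u) (hl : P (lossSet ρ) ≠ 0) (hg : P (gainSet ρ) ≠ 0) {N : ℕ}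
    {F : Path N → ℝ} {w : ℝ}
    (h : ∀ q : Fin N → Measure ℝ, (∀ i, q i ∈ oneStepMeasures P ρ) →
      Integrable F (Measure.pi q) ∧ ∫ y, F y ∂Measure.pi q ≤ w)
    {q : Fin N → Measure ℝ} (hq : ∀ i, q i ∈ relaxedMeasures P ρ) :
    Integrable F (Measure.pi q) ∧ ∫ y, F y ∂Measure.pi q ≤ w := by
  -- The set `s` collects the coordinates allowed to be relaxed; the induction frees one more of
  -- them each time.
  suffices ∀ (s : Finset (Fin N)) (q : Fin N → Measure ℝ), (∀ i, q i ∈ relaxedMeasures P ρ) →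
      (∀ i, i ∉ s → q i ∈ oneStepMeasures P ρ) →
      Integrable F (Measure.pi q) ∧ ∫ y, F y ∂Measure.pi q ≤ w from
    this Finset.univ q hq (fun i hi => absurd (Finset.mem_univ i) hi)
  intro s
  induction s using Finset.induction_on with
  | empty => exact fun q _ hq => h q fun i => hq i (Finset.notMem_empty i)
  | insert j s hj ih =>
    intro q hq hqs
    set Γ := twoPointMixture ρ (pairProb P ρ) with hΓ
    have hΓm := twoPointMixture_pairProb_mem hρ hρ1 hl hg
    have := fun i => isProbabilityMeasure_of_mem_relaxedMeasures hρ (hq i)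
    have := isProbabilityMeasure_of_mem_relaxedMeasures hρ
      (oneStepMeasures_subset_relaxedMeasures hρ hΓm)
    have key : ∀ a b : ℝ≥0, 0 < b → a + b = 1 →
        Integrable F (a • Measure.pi q + b • Measure.pi (Function.update q j Γ)) ∧
        ∫ y, F y ∂(a • Measure.pi q + b • Measure.pi (Function.update q j Γ)) ≤ w := by
      intro a b hb hab
      have hmem := combination_mem_oneStepMeasures hρ hρ1 hl hg (hq j) hb hab
      have e := pi_update_combination q j (q j) Γ a b
      rw [Function.update_eq_self] at e
      rw [← e]
      refine ih _ (fun i => ?_) (fun i hi => ?_)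
      · rcases eq_or_ne i j with rfl | hij
        · rw [Function.update_self]
          exact oneStepMeasures_subset_relaxedMeasures hρ hmem
        · rw [Function.update_of_ne hij]; exact hq i
      · rcases eq_or_ne i j with rfl | hij
        · rw [Function.update_self]; exact hmem
        · rw [Function.update_of_ne hij]; exact hqs i (by simp [hij, hi])
    -- Integrability under one nontrivial mixture gives integrability under both of its components.
    obtain ⟨i1, i2⟩ := integrable_add_measure.1
      (key (1 / 2) (1 / 2) (by norm_num) (by norm_num)).1
    have i1 := integrable_of_smul_nnreal (by norm_num) i1
    have i2 := integrable_of_smul_nnreal (by norm_num) i2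
    have key2 : ∀ a b : ℝ≥0, 0 < b → a + b = 1 → a * ∫ y, F y ∂Measure.pi q
        + b * ∫ y, F y ∂Measure.pi (Function.update q j Γ) ≤ w := by
      intro a b hb hab
      refine le_trans (le_of_eq ?_) (key a b hb hab).2
      rw [integral_add_measure (f := F) i1.smul_measure_nnreal i2.smul_measure_nnreal,
        integral_smul_nnreal_measure, integral_smul_nnreal_measure]
      rfl
    refine ⟨i1, le_of_forall_combination_le
      (y := ∫ y, F y ∂Measure.pi (Function.update q j Γ)) fun ε h0 h1 => ?_⟩
    have hk := key2 ⟨1 - ε, by linarith⟩ ⟨ε, h0.le⟩ h0 (NNReal.eq (sub_add_cancel 1 ε))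
    exact hk

end Relaxed

/-! ### Continuity of translation -/

/-- An approximation of `G` in `L¹` by a continuous compactly supported `h` changes the integral by
at most `C` times the `L¹` distance, uniformly in `t` by translation invariance; for `h` dominated
convergence applies. -/
theorem continuous_integral_comp_add {B : Measure ℝ} [IsFiniteMeasure B] {C : ℝ≥0}
    (hB : B ≤ C • volume) {G : ℝ → ℝ} (hG : Integrable G) :
    Continuous fun t => ∫ y, G (y + t) ∂B := by
  have hint : ∀ {K : ℝ → ℝ}, Integrable K → ∀ t, Integrable (fun y => K (y + t)) B :=
    fun hK t => ((hK.comp_add_right t).smul_measure_nnreal (c := C)).mono_measure hB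
  refine continuous_of_uniform_approx_of_continuous fun u hu => ?_
  obtain ⟨ε, hε, hεu⟩ := Metric.mem_uniformity_dist.1 hu
  have hC : (0 : ℝ) < C + 1 := by positivity
  obtain ⟨h, hs, hh, hc, hhi⟩ := hG.exists_hasCompactSupport_integral_sub_le
    (show 0 < ε / (2 * (C + 1)) by positivity)
  obtain ⟨M, hM⟩ := hs.exists_bound_of_continuous hc
  refine ⟨fun t => ∫ y, h (y + t) ∂B, ?_, fun t => hεu ?_⟩
  · refine continuous_of_dominated (bound := fun _ => M) (fun t => ?_) (fun t => ?_)
      (integrable_const M) ?_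
    · exact (hc.comp (continuous_id.add continuous_const)).aestronglyMeasurable
    · exact .of_forall fun y => hM _
    · exact .of_forall fun y => hc.comp (continuous_const.add continuous_id)
  · rw [Real.dist_eq, ← integral_sub (hint hG t) (hint hhi t)]
    have hd : Integrable (fun y => ‖G y - h y‖) := (hG.sub hhi).norm
    calc |∫ y, (G (y + t) - h (y + t)) ∂B| ≤ ∫ y, ‖G (y + t) - h (y + t)‖ ∂B :=
          (Real.norm_eq_abs _).symm.trans_le (norm_integral_le_integral_norm _)
      _ ≤ ∫ y, ‖G (y + t) - h (y + t)‖ ∂(C • volume) :=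
          integral_mono_measure hB (.of_forall fun y => norm_nonneg _)
            ((hd.comp_add_right t).smul_measure_nnreal)
      _ = C * ∫ y, ‖G y - h y‖ := by
          rw [integral_smul_nnreal_measure, integral_add_right_eq_self (fun y => ‖G y - h y‖)]
          rfl
      _ ≤ C * (ε / (2 * (C + 1))) := by gcongr
      _ < ε := by
          rw [mul_div_assoc', div_lt_iff₀ (by positivity)]
          nlinarith [C.coe_nonneg]

/-- For bounded `t` and `y` in the bounded carrier of `B`, only a cut-off of `g` matters, and the
cut-off is integrable. -/
theorem integrable_comp_add_and_continuous {B : Measure ℝ} [IsFiniteMeasure B] {C : ℝ≥0}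
    (hB : B ≤ C • volume) {R : ℝ} (hR : ∀ᵐ y ∂B, y ∈ Set.Icc (-R) R) {g : ℝ → ℝ}
    (hg : ∀ R, IntegrableOn g (Set.Icc (-R) R)) :
    (∀ t, Integrable (fun y => g (y + t)) B) ∧ Continuous fun t => ∫ y, g (y + t) ∂B := by
  have hG : ∀ T, Integrable ((Set.Icc (-T) T).indicator g) := fun T =>
    (hg T).integrable_indicator measurableSet_Icc
  have hae : ∀ T t, |t| ≤ T → (fun y => (Set.Icc (-(R + T)) (R + T)).indicator g (y + t))
      =ᵐ[B] fun y => g (y + t) := by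
    intro T t ht
    filter_upwards [hR] with y hy
    have := abs_le.1 ht
    have hm : y + t ∈ Set.Icc (-(R + T)) (R + T) := ⟨by linarith [hy.1], by linarith [hy.2]⟩
    exact Set.indicator_of_mem hm _
  refine ⟨fun t => ?_, continuous_iff_continuousAt.2 fun t₀ => ?_⟩
  · exact ((((hG _).comp_add_right t).smul_measure_nnreal (c := C)).mono_measure hB).congr
      (hae |t| t le_rfl)
  · refine (continuous_integral_comp_add hB (hG (R + (|t₀| + 1)))).continuousAt.congr ?_
    filter_upwards [Metric.ball_mem_nhds t₀ one_pos] with t ht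
    refine integral_congr_ae (hae _ _ ?_)
    rw [Metric.mem_ball, Real.dist_eq] at ht
    have := abs_sub_abs_le_abs_sub t t₀
    linarith

/-! ### Gaussian steps -/

section Gaussian

variable {Δt : ℝ}

theorem stepLaw_eq (hΔt : 0 < Δt) :
    stepLaw Δt = volume.withDensity (gaussianPDF 0 Δt.toNNReal) := by
  rw [stepLaw, gaussianReal_of_var_ne_zero _ (by simpa using hΔt)]

instance : IsProbabilityMeasure (stepLaw Δt) := by unfold stepLaw; infer_instance

theorem stepLaw_le (hΔt : 0 < Δt) : ∃ M : ℝ≥0, stepLaw Δt ≤ M • volume := by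
  refine ⟨(√(2 * Real.pi * Δt.toNNReal))⁻¹.toNNReal, ?_⟩
  rw [stepLaw_eq hΔt]
  refine (withDensity_mono (g := fun _ => ENNReal.ofReal (√(2 * Real.pi * Δt.toNNReal))⁻¹)
    (.of_forall fun y => ?_)).trans (by rw [withDensity_const]; rfl)
  refine ENNReal.ofReal_le_ofReal ?_
  rw [gaussianPDFReal]
  refine mul_le_of_le_one_right (by positivity) (Real.exp_le_one_iff.2 ?_)
  rw [neg_div]
  exact neg_nonpos.2 (by positivity)

theorem volume_restrict_le (hΔt : 0 < Δt) (R : ℝ) :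
    ∃ c : ℝ≥0, volume.restrict (Set.Icc (-R) R) ≤ c • (stepLaw Δt).restrict (Set.Icc (-R) R) := by
  have hv : (0 : ℝ) < Δt.toNNReal := by simpa using hΔt
  obtain ⟨k, hk, hkle⟩ : ∃ k : ℝ, 0 < k ∧
      ∀ y ∈ Set.Icc (-R) R, k ≤ gaussianPDFReal 0 Δt.toNNReal y := by
    refine ⟨(√(2 * Real.pi * Δt.toNNReal))⁻¹ * Real.exp (-R ^ 2 / (2 * Δt.toNNReal)),
      by positivity, fun y hy => ?_⟩
    rw [gaussianPDFReal]
    have h2 : (y - 0) ^ 2 ≤ R ^ 2 := by rw [sub_zero]; nlinarith [hy.1, hy.2]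
    gcongr
  refine ⟨k.toNNReal⁻¹, ?_⟩
  have h1 : k.toNNReal • volume.restrict (Set.Icc (-R) R)
      ≤ (stepLaw Δt).restrict (Set.Icc (-R) R) := by
    rw [stepLaw_eq hΔt, restrict_withDensity measurableSet_Icc]
    refine le_trans ?_ (withDensity_mono (f := fun _ => ENNReal.ofReal k) ?_)
    · rw [withDensity_const]; rfl
    · filter_upwards [ae_restrict_mem measurableSet_Icc] with y hy
      exact ENNReal.ofReal_le_ofReal (hkle y hy)
  have hk0 : k.toNNReal ≠ 0 := by simpa using hk
  calc volume.restrict (Set.Icc (-R) R)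
      = k.toNNReal⁻¹ • k.toNNReal • volume.restrict (Set.Icc (-R) R) := by
        rw [smul_smul, inv_mul_cancel₀ hk0, one_smul]
    _ ≤ _ := by
        refine Measure.le_iff.2 fun s _ => ?_
        simp only [Measure.smul_apply (k.toNNReal⁻¹)]
        gcongr

theorem stepLaw_ne_zero (hΔt : 0 < Δt) {s : Set ℝ} (hs : volume s ≠ 0) : stepLaw Δt s ≠ 0 :=
  fun h => hs (gaussianReal_absolutelyContinuous' 0 (by simpa using hΔt) h)

end Gaussian

/-! ### Local integrability from integrability under the mixtures -/

section LocalIntegrability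

variable {P : Measure ℝ} {ρ : ℝ → ℝ} {g : ℝ → ℝ}

theorem integrable_of_mul_ge {α : Type*} [MeasurableSpace α] {m : Measure α} {F k : α → ℝ} {c : ℝ}
    (hc : 0 < c) (hF : AEStronglyMeasurable F m) (hk : ∀ᵐ a ∂m, c ≤ k a)
    (h : Integrable (fun a => k a * F a) m) : Integrable F m := by
  refine (h.norm.const_mul c⁻¹).mono' hF ?_
  filter_upwards [hk] with a ha
  rw [norm_mul, Real.norm_of_nonneg (hc.le.trans ha), ← mul_assoc]
  refine le_mul_of_one_le_left (norm_nonneg _) ?_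
  rw [← div_eq_inv_mul]
  exact (one_le_div hc).2 ha

theorem integrableOn_lossSet [IsFiniteMeasure P] (hρ : Measurable ρ) (hρ1 : ∀ u, 0 ≤ 1 + ρ u)
    (hgain : P (gainSet ρ) ≠ 0) (hgm : Measurable g)
    (hg : Integrable (fun p => lossMass ρ p * g p.1) (pairLaw P ρ)) :
    IntegrableOn g (lossSet ρ) P := by
  have h1 := hg.prod_left_ae
  have h2 : ∀ᵐ v ∂P.restrict (gainSet ρ), v ∈ gainSet ρ := ae_restrict_mem (measurableSet_gainSet hρ)
  have : NeZero (P.restrict (gainSet ρ)) := ⟨by simpa using hgain⟩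
  obtain ⟨v, hv1, hv2⟩ := (h1.and h2).exists
  have hv : 0 < ρ v := hv2
  -- For fixed `v` the loss mass is `ρ v / (ρ v - ρ u)`, which is at least this constant because `-ρ
  -- u ≤ 1`.
  refine integrable_of_mul_ge (c := ρ v / (1 + ρ v)) (by positivity) hgm.aestronglyMeasurable ?_ hv1
  filter_upwards [ae_restrict_mem (measurableSet_lossSet hρ)] with u hu
  rw [lossMass_eq (show ρ u ≤ 0 from hu) hv]
  have hu' : ρ u ≤ 0 := hu
  have := hρ1 u
  gcongr
  · simp only; linarith
  · simp only; linarith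

/-- For a fixed `u` the gain mass decays as the gain grows, hence the cut-off at `M`; it vanishes
when `ρ u = 0`, hence the choice of `u` with strict loss. -/
theorem integrableOn_gainSet [IsFiniteMeasure P] (hρ : Measurable ρ)
    (hloss : P {u | ρ u < 0} ≠ 0) (hgm : Measurable g)
    (hg : Integrable (fun p => gainMass ρ p * g p.2) (pairLaw P ρ)) (M : ℝ) :
    IntegrableOn g (gainSet ρ ∩ {v | ρ v ≤ M}) P := by
  have h1 := hg.prod_right_ae
  have hsub : {u | ρ u < 0} ⊆ lossSet ρ := fun u (hu : ρ u < 0) => hu.le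
  have h2 : ∃ᵐ u ∂P.restrict (lossSet ρ), ρ u < 0 := by
    rw [frequently_ae_iff, Measure.restrict_apply (measurableSet_lt hρ measurable_const),
      Set.inter_eq_left.2 hsub]
    exact hloss
  obtain ⟨u, hu, hu1⟩ := (h2.and_eventually h1).exists
  have hms : MeasurableSet (gainSet ρ ∩ {v | ρ v ≤ M}) :=
    (measurableSet_gainSet hρ).inter (measurableSet_le hρ measurable_const)
  have hu2 : Integrable (fun v => gainMass ρ (u, v) * g v)
      (P.restrict (gainSet ρ ∩ {v | ρ v ≤ M})) :=
    hu1.mono_measure (Measure.restrict_mono_set _ Set.inter_subset_left)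
  refine integrable_of_mul_ge (c := -ρ u / (|M| - ρ u)) ?_ hgm.aestronglyMeasurable ?_ hu2
  · have := abs_nonneg M
    exact div_pos (by linarith) (by linarith)
  filter_upwards [ae_restrict_mem hms] with v hv
  have hv0 : 0 < ρ v := hv.1
  have hvM : ρ v ≤ M := hv.2
  rw [gainMass_eq (p := (u, v)) hu.le hv0]
  have := le_abs_self M
  exact div_le_div_of_nonneg_left (by linarith) (by linarith) (by linarith)

end LocalIntegrability

/-! ### Specialisation to the Gaussian model. -/

section Model

variable {μ σ r Δt : ℝ}

theorem lossSet_rho (hσ : 0 < σ) : lossSet (rho μ σ r Δt) = Set.Iic (-shift μ σ r Δt) := by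
  ext y; exact rho_nonpos_iff hσ μ r Δt y

theorem gainSet_rho (hσ : 0 < σ) : gainSet (rho μ σ r Δt) = Set.Ioi (-shift μ σ r Δt) := by
  ext y; exact rho_pos_iff hσ μ r Δt y

theorem stepLaw_lossSet_ne_zero (hΔt : 0 < Δt) (hσ : 0 < σ) :
    stepLaw Δt (lossSet (rho μ σ r Δt)) ≠ 0 :=
  stepLaw_ne_zero hΔt (by rw [lossSet_rho hσ]; simp)

theorem stepLaw_gainSet_ne_zero (hΔt : 0 < Δt) (hσ : 0 < σ) :
    stepLaw Δt (gainSet (rho μ σ r Δt)) ≠ 0 :=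
  stepLaw_ne_zero hΔt (by rw [gainSet_rho hσ]; simp)

theorem integrableOn_Icc_of_integrable_mixture (hΔt : 0 < Δt) (hσ : 0 < σ) {g : ℝ → ℝ}
    (hgm : Measurable g)
    (hg : Integrable g (twoPointMixture (rho μ σ r Δt) (pairProb (stepLaw Δt) (rho μ σ r Δt))))
    (R : ℝ) : IntegrableOn g (Set.Icc (-R) R) := by
  have hρ := measurable_rho μ σ r Δt
  obtain ⟨h1, h2⟩ := integrable_twoPointMixture hρ hgm hg
  have hc : (pairLaw (stepLaw Δt) (rho μ σ r Δt) Set.univ).toNNReal⁻¹ ≠ 0 :=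
    inv_ne_zero (by
      simp [ENNReal.toNNReal_eq_zero_iff, pairLaw_univ_ne_zero
        (stepLaw_lossSet_ne_zero (μ := μ) (r := r) hΔt hσ) (stepLaw_gainSet_ne_zero hΔt hσ)])
  have i1 := integrableOn_lossSet hρ (fun u => (one_add_rho_pos _ _ _ _ u).le)
    (stepLaw_gainSet_ne_zero hΔt hσ) hgm (integrable_of_smul_nnreal hc h1)
  have i2 := integrableOn_gainSet hρ (stepLaw_ne_zero hΔt (ne_of_gt
    (lt_of_lt_of_le (b := volume (Set.Iio (-shift μ σ r Δt))) (by simp) (measure_mono ?_))))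
    hgm (integrable_of_smul_nnreal hc h2) (rho μ σ r Δt R)
  · have i3 : IntegrableOn g (Set.Icc (-R) R) (stepLaw Δt) := by
      refine (i1.union i2).mono_set fun y hy => ?_
      rcases le_or_gt (rho μ σ r Δt y) 0 with h | h
      · exact Or.inl h
      · refine Or.inr ⟨h, ?_⟩
        change rho μ σ r Δt y ≤ rho μ σ r Δt R
        have := hy.2
        rw [rho_eq hσ.ne', rho_eq hσ.ne']
        gcongr
    obtain ⟨c, hc⟩ := volume_restrict_le hΔt R
    exact (i3.smul_measure_nnreal (c := c)).mono_measure hc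
  · intro y hy
    have h := (rho_nonpos_iff hσ μ r Δt y).2 (le_of_lt hy)
    refine lt_of_le_of_ne h fun h0 => ?_
    rw [rho_eq hσ.ne', sub_eq_zero, Real.exp_eq_one_iff] at h0
    have : shift μ σ r Δt + y = 0 := by simpa [hσ.ne'] using h0
    have hy' : y < -shift μ σ r Δt := hy
    linarith

/-! ### Mixtures over small boxes -/

/-- The weights are at most one, and both marginals of the conditioned pair law are bounded by
multiples of the Gaussian law, hence of Lebesgue measure. The factor 2 counts the two marginals. -/
theorem exists_mixture_le (hΔt : 0 < Δt) {E : Set (ℝ × ℝ)} :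
    ∃ C : ℝ≥0, twoPointMixture (rho μ σ r Δt)
      ((pairLaw (stepLaw Δt) (rho μ σ r Δt))[|E]) ≤ C • volume := by
  set ν := pairLaw (stepLaw Δt) (rho μ σ r Δt) with hν
  rcases eq_or_ne (ν E) 0 with h0 | h0
  · refine ⟨0, ?_⟩
    rw [cond_eq_zero_of_meas_eq_zero h0]
    simp [twoPointMixture]
  obtain ⟨M, hM⟩ := stepLaw_le hΔt
  have hρ := measurable_rho μ σ r Δt
  obtain ⟨c, hc⟩ : ∃ c : ℝ≥0, ν[|E] ≤ c • (stepLaw Δt).prod (stepLaw Δt) := by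
    refine ⟨(ν E)⁻¹.toNNReal, ?_⟩
    refine Measure.le_iff.2 fun s _ => ?_
    rw [ProbabilityTheory.cond, Measure.smul_apply, Measure.smul_apply, ENNReal.smul_def,
      ENNReal.coe_toNNReal (ENNReal.inv_ne_top.2 h0)]
    gcongr
    refine Measure.restrict_le_self.trans ?_
    rw [hν, pairLaw_eq_restrict]
    exact Measure.restrict_le_self
  refine ⟨2 * (c * M), Measure.le_iff.2 fun s hs => ?_⟩
  have hcyl : ∀ T : Set (ℝ × ℝ), (stepLaw Δt).prod (stepLaw Δt) T = stepLaw Δt s →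
      ν[|E] T ≤ (c * M : ℝ≥0) * volume s := fun T hT => by
    calc ν[|E] T ≤ (c • (stepLaw Δt).prod (stepLaw Δt)) T := hc T
      _ = c * stepLaw Δt s := by rw [Measure.smul_apply, hT]; rfl
      _ ≤ c * (M * volume s) := by
          gcongr
          exact hM s
      _ = _ := by rw [ENNReal.coe_mul, mul_assoc]
  have hi1 : Measurable fun p : ℝ × ℝ => s.indicator (1 : ℝ → ℝ≥0∞) p.1 :=
    (measurable_one.indicator hs).comp measurable_fst
  have hlm : ∀ p, ENNReal.ofReal (lossMass (rho μ σ r Δt) p) ≤ 1 := fun p =>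
    ENNReal.ofReal_le_one.2 (div_le_one_of_le₀ (by simp) (by positivity))
  have hgm : ∀ p, ENNReal.ofReal (gainMass (rho μ σ r Δt) p) ≤ 1 := fun p =>
    ENNReal.ofReal_le_one.2 (div_le_one_of_le₀ (by simp) (by positivity))
  rw [twoPointMixture_apply hρ _ hs]
  calc _ ≤ ∫⁻ p, (s.indicator (1 : ℝ → ℝ≥0∞) p.1 + s.indicator (1 : ℝ → ℝ≥0∞) p.2) ∂ν[|E] :=
        lintegral_mono fun p => add_le_add (mul_le_of_le_one_left' (hlm p))
          (mul_le_of_le_one_left' (hgm p))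
    _ = ν[|E] (Prod.fst ⁻¹' s) + ν[|E] (Prod.snd ⁻¹' s) := by
        rw [lintegral_add_left hi1, ← lintegral_indicator_one (measurable_fst hs),
          ← lintegral_indicator_one (measurable_snd hs)]
        rfl
    _ ≤ (c * M : ℝ≥0) * volume s + (c * M : ℝ≥0) * volume s := by
        refine add_le_add (hcyl _ ?_) (hcyl _ ?_)
        · rw [← Set.prod_univ, Measure.prod_prod, measure_univ, mul_one]
        · rw [← Set.univ_prod, Measure.prod_prod, measure_univ, one_mul]
    _ = _ := by
        rw [Measure.smul_apply, ENNReal.smul_def, smul_eq_mul, ENNReal.coe_mul 2, ENNReal.coe_ofNat]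
        ring

theorem ae_twoPointMixture_mem {ρ : ℝ → ℝ} (hρ : Measurable ρ) {m : Measure (ℝ × ℝ)} {A : Set ℝ}
    (hA : MeasurableSet A) (h : ∀ᵐ p ∂m, p.1 ∈ A ∧ p.2 ∈ A) :
    ∀ᵐ y ∂twoPointMixture ρ m, y ∈ A := by
  rw [ae_iff]
  change twoPointMixture ρ m Aᶜ = 0
  rw [twoPointMixture_apply hρ _ hA.compl, lintegral_eq_zero_iff']
  · filter_upwards [h] with p hp
    simp [hp.1, hp.2]
  · exact (((measurable_ofReal_lossMass hρ).mul
      ((measurable_one.indicator hA.compl).comp measurable_fst)).add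
      ((measurable_ofReal_gainMass hρ).mul
      ((measurable_one.indicator hA.compl).comp measurable_snd))).aemeasurable

theorem pairLaw_prod_ne_zero (hΔt : 0 < Δt) (hσ : 0 < σ) {A B : Set ℝ}
    (hA : A ⊆ Set.Iic (-shift μ σ r Δt)) (hB : B ⊆ Set.Ioi (-shift μ σ r Δt))
    (hA0 : volume A ≠ 0) (hB0 : volume B ≠ 0) :
    pairLaw (stepLaw Δt) (rho μ σ r Δt) (A ×ˢ B) ≠ 0 := by
  rw [pairLaw, Measure.prod_prod, lossSet_rho hσ, gainSet_rho hσ,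
    Measure.restrict_eq_self _ hA, Measure.restrict_eq_self _ hB]
  exact mul_ne_zero (stepLaw_ne_zero hΔt hA0) (stepLaw_ne_zero hΔt hB0)

/-- The regularity of `f` passes to the logarithmic coordinate, because the differentiable map `φ`
sends null sets to null sets. -/
theorem volume_preimage_exp_ne_zero {f : ℝ → ℝ} {S : ℝ} (hS : 0 < S) (hσ : 0 < σ)
    (hreg : ∀ s : ℝ, 0 < s → ∀ c : ℝ, c < f s → ∀ U ∈ 𝓝 s, 0 < volume (U ∩ {t | c < f t}))
    {u c : ℝ} (hc : c < f (S * Real.exp (σ * u))) {U : Set ℝ} (hU : U ∈ 𝓝 u) :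
    volume (U ∩ {y | c < f (S * Real.exp (σ * y))}) ≠ 0 := by
  intro h0
  set φ : ℝ → ℝ := fun y => S * Real.exp (σ * y) with hφ
  have hpos : 0 < φ u := by positivity
  set ψ : ℝ → ℝ := fun s => Real.log (s / S) / σ with hψ
  have hψφ : ψ (φ u) = u := by
    simp only [hφ, hψ]
    rw [mul_div_cancel_left₀ _ hS.ne', Real.log_exp, mul_div_cancel_left₀ _ hσ.ne']
  have hcont : ContinuousAt ψ (φ u) := by
    have : φ u / S ≠ 0 := by positivity
    simp only [hψ]
    fun_prop (disch := assumption)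
  have hnhds : ψ ⁻¹' U ∩ Set.Ioi 0 ∈ 𝓝 (φ u) :=
    Filter.inter_mem (hcont.preimage_mem_nhds (by rwa [hψφ])) (Ioi_mem_nhds hpos)
  refine (hreg _ hpos c hc _ hnhds).ne' (measure_mono_null ?_
    (addHaar_image_eq_zero_of_differentiableOn_of_addHaar_eq_zero volume (f := φ) ?_ h0))
  · rintro s ⟨⟨hsU, hs⟩, hcs⟩
    have hs' : 0 < s := hs
    have e : φ (ψ s) = s := by
      simp only [hφ, hψ]
      rw [mul_div_cancel₀ _ hσ.ne', Real.exp_log (by positivity), mul_div_cancel₀ _ hS.ne']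
    exact ⟨ψ s, ⟨hsU, by change c < f (φ (ψ s)); rwa [e]⟩, e⟩
  · have : Differentiable ℝ φ := by simp only [hφ]; fun_prop
    exact this.differentiableOn

end Model

/-! ### Chords are attained in the limit -/

section Model

variable {μ σ r Δt : ℝ}

theorem price_eq_exp {N : ℕ} (hσ : σ ≠ 0) (S₀ : ℝ) (y : Path N) :
    price S₀ μ σ r Δt N y = S₀ * Real.exp (σ * ∑ i, (y i + shift μ σ r Δt)) := by
  rw [price_eq_prod]
  simp only [one_add_rho hσ, ← Real.exp_sum, Finset.mul_sum]
  congr 2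
  exact Finset.sum_congr rfl fun i _ => by ring

theorem price_cons {N : ℕ} (hσ : σ ≠ 0) (S₀ u : ℝ) (y : Path N) :
    price S₀ μ σ r Δt (N + 1) (Fin.cons u y)
      = S₀ * Real.exp (σ * (u + (shift μ σ r Δt + ∑ i, (y i + shift μ σ r Δt)))) := by
  rw [price_eq_exp hσ, Fin.sum_univ_succ]
  simp [add_assoc]

/-- By Fubini, all coordinates but the first can be frozen; they act only as a translation by `τ`.
-/
theorem integrableOn_Icc_of_integrable_price {N : ℕ} {S₀ : ℝ} (hΔt : 0 < Δt) (hσ : 0 < σ)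
    {f : ℝ → ℝ} (hf : Measurable f)
    (h : Integrable (fun y => f (price S₀ μ σ r Δt (N + 1) y)) (Measure.pi fun _ : Fin (N + 1) =>
      twoPointMixture (rho μ σ r Δt) (pairProb (stepLaw Δt) (rho μ σ r Δt)))) (R : ℝ) :
    IntegrableOn (fun u => f (S₀ * Real.exp (σ * u))) (Set.Icc (-R) R) := by
  have hρ := measurable_rho μ σ r Δt
  have hΓ := isProbabilityMeasure_of_mem_relaxedMeasures hρ
    (oneStepMeasures_subset_relaxedMeasures hρ
      (twoPointMixture_pairProb_mem hρ (fun u => (one_add_rho_pos μ σ r Δt u).le)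
      (stepLaw_lossSet_ne_zero hΔt hσ) (stepLaw_gainSet_ne_zero hΔt hσ)))
  set Γ := twoPointMixture (rho μ σ r Δt) (pairProb (stepLaw Δt) (rho μ σ r Δt)) with hΓdef
  have h' := (measurePreserving_cons (N := N) fun _ => Γ).integrable_comp_of_integrable h
  obtain ⟨y, hy⟩ := h'.prod_left_ae.exists
  simp only [Function.comp_def, price_cons hσ.ne'] at hy
  set τ := shift μ σ r Δt + ∑ i, (y i + shift μ σ r Δt) with hτ
  have hi := integrableOn_Icc_of_integrable_mixture hΔt hσ
    (g := fun u => f (S₀ * Real.exp (σ * (u + τ)))) (by fun_prop) hy (R + |τ|)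
  have hmp := measurePreserving_add_right (volume : Measure ℝ) τ
  have hi' : IntegrableOn ((fun u => f (S₀ * Real.exp (σ * u))) ∘ (· + τ))
      ((· + τ) ⁻¹' Set.Icc (-R) R) := by
    refine hi.mono_set fun u hu => ?_
    have h1 := le_abs_self τ
    have h2 := neg_abs_le τ
    have h3 : -R ≤ u + τ := hu.1
    have h4 : u + τ ≤ R := hu.2
    exact ⟨by linarith, by linarith⟩
  exact (hmp.integrableOn_comp_preimage (measurableEmbedding_addRight τ)).1 hi'

theorem exists_relaxed_near_zero (hΔt : 0 < Δt) (hσ : 0 < σ) {κ : ℝ} (hκ : 0 < κ) :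
    ∃ Q ∈ relaxedMeasures (stepLaw Δt) (rho μ σ r Δt), ∀ᵐ y ∂Q, |y + shift μ σ r Δt| < κ := by
  have hρ := measurable_rho μ σ r Δt
  set d := shift μ σ r Δt with hd
  have hE := pairLaw_prod_ne_zero (μ := μ) (r := r) hΔt hσ (A := Set.Ioo (-d - κ) (-d))
    (B := Set.Ioo (-d) (-d + κ)) (fun y hy => hy.2.le) (fun y hy => hy.1)
    (by simpa using hκ) (by simpa using hκ)
  have := cond_isProbabilityMeasure hE
  refine ⟨_, ⟨_, this, cond_absolutelyContinuous, rfl⟩, ?_⟩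
  have hA : ∀ᵐ y ∂twoPointMixture (rho μ σ r Δt) ((pairLaw (stepLaw Δt)
      (rho μ σ r Δt))[|Set.Ioo (-d - κ) (-d) ×ˢ Set.Ioo (-d) (-d + κ)]),
      y ∈ Set.Ioo (-d - κ) (-d + κ) := by
    refine ae_twoPointMixture_mem hρ measurableSet_Ioo ?_
    filter_upwards [ae_cond_mem (measurableSet_Ioo.prod measurableSet_Ioo)] with p hp
    obtain ⟨⟨h1, h2⟩, ⟨h3, h4⟩⟩ := hp
    exact ⟨⟨h1, by linarith⟩, ⟨by linarith, h4⟩⟩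
  filter_upwards [hA] with y hy
  exact abs_lt.2 ⟨by linarith [hy.1], by linarith [hy.2]⟩

/-- The pair law is conditioned on pairs near `p` at which `g` exceeds `a` and `b`. The masses vary
continuously, and the strict inequalities at `-d` keep both balls on their own sides. -/
theorem exists_relaxed_integral_ge (hΔt : 0 < Δt) (hσ : 0 < σ) {g : ℝ → ℝ} (hgm : Measurable g)
    (hg : ∀ R, IntegrableOn g (Set.Icc (-R) R)) {p : ℝ × ℝ} {a b : ℝ}
    (hp1 : p.1 < -shift μ σ r Δt) (hp2 : -shift μ σ r Δt < p.2)
    (ha : ∀ U ∈ 𝓝 p.1, volume (U ∩ {y | a < g y}) ≠ 0)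
    (hb : ∀ U ∈ 𝓝 p.2, volume (U ∩ {y | b < g y}) ≠ 0) {η : ℝ} (hη : 0 < η) :
    ∃ Q ∈ relaxedMeasures (stepLaw Δt) (rho μ σ r Δt),
      (∀ t, Integrable (fun y => g (y + t)) Q) ∧ (Continuous fun t => ∫ y, g (y + t) ∂Q) ∧
      lossMass (rho μ σ r Δt) p * a + gainMass (rho μ σ r Δt) p * b - η ≤ ∫ y, g y ∂Q := by
  have hρ := measurable_rho μ σ r Δt
  set ρ := rho μ σ r Δt with hρdef
  have hρp : 0 < ρ p.2 := (rho_pos_iff hσ μ r Δt _).2 hp2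
  have hc : ContinuousAt (fun z => lossMass ρ z * a + gainMass ρ z * b) p :=
    ((continuousAt_lossMass (continuous_rho _ _ _ _) hρp).mul continuousAt_const).add
      ((continuousAt_gainMass (continuous_rho _ _ _ _) hρp).mul continuousAt_const)
  have hev := hc.eventually_const_lt (sub_lt_self _ hη)
  rw [← Prod.mk.eta (p := p), nhds_prod_eq, Filter.eventually_prod_iff] at hev
  obtain ⟨pa, hpa, pb, hpb, hab⟩ := hev
  obtain ⟨δ₁, hδ₁, h₁⟩ := Metric.eventually_nhds_iff_ball.1 (hpa.and (Iio_mem_nhds hp1))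
  obtain ⟨δ₂, hδ₂, h₂⟩ := Metric.eventually_nhds_iff_ball.1 (hpb.and (Ioi_mem_nhds hp2))
  set A := Metric.ball p.1 δ₁ ∩ {y | a < g y} with hA
  set B := Metric.ball p.2 δ₂ ∩ {y | b < g y} with hB
  have hAm : MeasurableSet A := measurableSet_ball.inter (measurableSet_lt measurable_const hgm)
  have hBm : MeasurableSet B := measurableSet_ball.inter (measurableSet_lt measurable_const hgm)
  have hE := pairLaw_prod_ne_zero (μ := μ) (r := r) hΔt hσ (A := A) (B := B)
    (fun y hy => le_of_lt (h₁ y hy.1).2) (fun y hy => (h₂ y hy.1).2)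
    (ha _ (Metric.ball_mem_nhds _ hδ₁)) (hb _ (Metric.ball_mem_nhds _ hδ₂))
  have hprob := cond_isProbabilityMeasure hE
  set m := (pairLaw (stepLaw Δt) ρ)[|A ×ˢ B] with hm
  have hmem : twoPointMixture ρ m ∈ relaxedMeasures (stepLaw Δt) ρ :=
    ⟨m, hprob, cond_absolutelyContinuous, rfl⟩
  have := isProbabilityMeasure_of_mem_relaxedMeasures hρ hmem
  have hmE : ∀ᵐ z ∂m, z ∈ A ×ˢ B := ae_cond_mem (hAm.prod hBm)
  obtain ⟨C, hC⟩ := exists_mixture_le (μ := μ) (σ := σ) (r := r) hΔt (E := A ×ˢ B)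
  have hR : ∀ᵐ y ∂twoPointMixture ρ m,
      y ∈ Set.Icc (-(|p.1| + |p.2| + δ₁ + δ₂)) (|p.1| + |p.2| + δ₁ + δ₂) := by
    refine ae_twoPointMixture_mem hρ measurableSet_Icc ?_
    filter_upwards [hmE] with z hz
    have z1 := hz.1.1
    have z2 := hz.2.1
    rw [Metric.mem_ball, Real.dist_eq, abs_lt] at z1 z2
    have := le_abs_self p.1
    have := le_abs_self p.2
    have := neg_abs_le p.1
    have := neg_abs_le p.2
    exact ⟨⟨by linarith, by linarith⟩, ⟨by linarith, by linarith⟩⟩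
  obtain ⟨hint, hcont⟩ := integrable_comp_add_and_continuous hC hR hg
  have hint0 : Integrable g (twoPointMixture ρ m) := by simpa using hint 0
  refine ⟨_, hmem, hint, hcont, ?_⟩
  obtain ⟨j1, j2⟩ := integrable_twoPointMixture hρ hgm hint0
  rw [integral_twoPointMixture hρ hgm hint0]
  calc _ = ∫ _, (lossMass ρ p * a + gainMass ρ p * b - η) ∂m := by simp
    _ ≤ _ := by
      refine integral_mono_ae (integrable_const _) (j1.add j2) ?_
      filter_upwards [hmE] with z hz
      refine (hab (h₁ _ hz.1.1).1 (h₂ _ hz.2.1).1).le.trans ?_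
      exact add_le_add (mul_le_mul_of_nonneg_left (le_of_lt hz.1.2) (lossMass_nonneg _ _))
        (mul_le_mul_of_nonneg_left (le_of_lt hz.2.2) (gainMass_nonneg _ _))

theorem le_integral_pi_cons {N : ℕ} {S₀ : ℝ} (hΔt : 0 < Δt) (hσ : 0 < σ) {f : ℝ → ℝ} {w c : ℝ}
    (hw : ∀ q : Fin (N + 1) → Measure ℝ, (∀ i, q i ∈ relaxedMeasures (stepLaw Δt) (rho μ σ r Δt)) →
      Integrable (fun y => f (price S₀ μ σ r Δt (N + 1) y)) (Measure.pi q) ∧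
        ∫ y, f (price S₀ μ σ r Δt (N + 1) y) ∂Measure.pi q ≤ w)
    {Q : Measure ℝ} (hQ : Q ∈ relaxedMeasures (stepLaw Δt) (rho μ σ r Δt))
    (hcont : Continuous fun t => ∫ y, f (S₀ * Real.exp (σ * (y + t))) ∂Q)
    (hc : c < ∫ y, f (S₀ * Real.exp (σ * (y + shift μ σ r Δt))) ∂Q) : c ≤ w := by
  have hρ := measurable_rho μ σ r Δt
  obtain ⟨δ, hδ, hball⟩ := Metric.eventually_nhds_iff_ball.1
    (hcont.continuousAt.eventually_const_lt hc)
  obtain ⟨Q', hQ', hQ'near⟩ := exists_relaxed_near_zero (μ := μ) (r := r) hΔt hσ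
    -- The `N` later steps together displace the exponent by less than `δ`.
    (show 0 < δ / (N + 1) by positivity)
  let q : Fin (N + 1) → Measure ℝ := Fin.cons Q fun _ => Q'
  have hq : ∀ i, q i ∈ relaxedMeasures (stepLaw Δt) (rho μ σ r Δt) := fun i => by
    refine Fin.cases ?_ (fun i => ?_) i
    · exact hQ
    · exact hQ'
  have := fun i => isProbabilityMeasure_of_mem_relaxedMeasures hρ (hq i)
  have := isProbabilityMeasure_of_mem_relaxedMeasures hρ hQ
  have := isProbabilityMeasure_of_mem_relaxedMeasures hρ hQ'
  obtain ⟨hi, hle⟩ := hw q hq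
  have mp : MeasurePreserving (fun z : ℝ × Path N => (Fin.cons z.1 z.2 : Path (N + 1)))
    (Q.prod (Measure.pi fun _ => Q')) (Measure.pi q) := measurePreserving_cons q
  refine le_trans ?_ hle
  have hi' := mp.integrable_comp_of_integrable hi
  simp only [Function.comp_def] at hi'
  rw [← mp.integral_comp measurableEmbedding_cons, integral_prod_symm _ hi']
  simp only [price_cons hσ.ne'] at hi' ⊢
  calc c = ∫ _, c ∂(Measure.pi fun _ : Fin N => Q') := by simp
    _ ≤ _ := by
      refine integral_mono_ae (integrable_const _) hi'.integral_prod_right ?_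
      have hall : ∀ᵐ y ∂(Measure.pi fun _ : Fin N => Q'), ∀ i,
          |y i + shift μ σ r Δt| < δ / (N + 1) :=
        ae_all_iff.2 fun i => (Measure.quasiMeasurePreserving_eval (fun _ => Q') i).ae hQ'near
      filter_upwards [hall] with y hy
      refine (hball _ ?_).le
      rw [Metric.mem_ball, Real.dist_eq, add_sub_cancel_left]
      calc |∑ i, (y i + shift μ σ r Δt)| ≤ ∑ i, |y i + shift μ σ r Δt| :=
            Finset.abs_sum_le_sum_abs _ _
        _ ≤ ∑ _i : Fin N, δ / (N + 1) := Finset.sum_le_sum fun i _ => (hy i).le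
        _ < δ := by
            rw [Finset.sum_const, Finset.card_univ, Fintype.card_fin, nsmul_eq_mul,
              mul_div_assoc', div_lt_iff₀ (by positivity)]
            nlinarith

theorem chord_le_of_lt {N : ℕ} {S₀ : ℝ} (hS₀ : 0 < S₀) (hΔt : 0 < Δt) (hσ : 0 < σ) {f : ℝ → ℝ}
    (hf : Measurable f)
    (hreg : ∀ s : ℝ, 0 < s → ∀ c : ℝ, c < f s → ∀ U ∈ 𝓝 s, 0 < volume (U ∩ {t | c < f t}))
    {w : ℝ}
    (hw : ∀ q : Fin (N + 1) → Measure ℝ, (∀ i, q i ∈ oneStepMeasures (stepLaw Δt) (rho μ σ r Δt)) →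
      Integrable (fun y => f (price S₀ μ σ r Δt (N + 1) y)) (Measure.pi q) ∧
        ∫ y, f (price S₀ μ σ r Δt (N + 1) y) ∂Measure.pi q ≤ w)
    {a b : ℝ} (ha : 0 < a) (haS : a < S₀) (hSb : S₀ < b) : chord f S₀ a b ≤ w := by
  have hρ := measurable_rho μ σ r Δt
  have hρ1 : ∀ u, 0 ≤ 1 + rho μ σ r Δt u := fun u => (one_add_rho_pos _ _ _ _ u).le
  have hl := stepLaw_lossSet_ne_zero (μ := μ) (r := r) hΔt hσ
  have hg := stepLaw_gainSet_ne_zero (μ := μ) (r := r) hΔt hσ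
  set d := shift μ σ r Δt with hd
  have hloc := integrableOn_Icc_of_integrable_price hΔt hσ hf
    (hw _ fun _ => twoPointMixture_pairProb_mem hρ hρ1 hl hg).1
  have hwr := fun q hq => integral_le_of_relaxed hρ hρ1 hl hg hw (q := q) hq
  obtain ⟨u, hu⟩ := exists_one_add_rho_eq hσ.ne' μ r Δt (div_pos ha hS₀)
  obtain ⟨v, hv⟩ := exists_one_add_rho_eq hσ.ne' μ r Δt (div_pos (hS₀.trans hSb) hS₀)
  have hu0 : rho μ σ r Δt u < 0 := by
    have := (div_lt_one hS₀).2 haS; linarith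
  have hv0 : 0 < rho μ σ r Δt v := by
    have := (one_lt_div hS₀).2 hSb; linarith
  have hud : u < -d := by
    refine lt_of_le_of_ne ((rho_nonpos_iff hσ _ _ _ _).1 hu0.le) ?_
    rintro rfl
    simp [rho_eq hσ.ne', ← hd] at hu0
  have hvd : -d < v := (rho_pos_iff hσ _ _ _ _).1 hv0
  have hfa : f (S₀ * Real.exp (σ * (u + d))) = f a := by
    rw [add_comm u d, hd, ← one_add_rho hσ.ne', hu, mul_div_cancel₀ _ hS₀.ne']
  have hfb : f (S₀ * Real.exp (σ * (v + d))) = f b := by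
    rw [add_comm v d, hd, ← one_add_rho hσ.ne', hv, mul_div_cancel₀ _ hS₀.ne']
  have hchord := chord_eq_pairWeight hS₀.ne' (p := (u, v)) f hu0.le hv0
  simp only [hu, hv, mul_div_cancel₀ _ hS₀.ne'] at hchord
  rw [hchord]
  have hsum := lossMass_add_gainMass (p := (u, v)) hu0.le hv0
  refine le_of_forall_pos_le_add fun ε hε => ?_
  have hpre : ∀ x c : ℝ, c < f (S₀ * Real.exp (σ * (x + d))) → ∀ U ∈ 𝓝 x,
      volume (U ∩ {y | c < f (S₀ * Real.exp (σ * (y + d)))}) ≠ 0 := by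
    intro x c hc U hU
    have hU' : (· - d) ⁻¹' U ∈ 𝓝 (x + d) := by
      refine (continuous_sub_right d).continuousAt.preimage_mem_nhds ?_
      simpa using hU
    have := volume_preimage_exp_ne_zero hS₀ hσ hreg hc hU'
    rw [← measure_preimage_add_right volume d] at this
    simpa [Set.preimage_inter, Set.preimage_preimage] using this
  have hloc' : ∀ R, IntegrableOn (fun y => f (S₀ * Real.exp (σ * (y + d)))) (Set.Icc (-R) R) := by
    intro R
    have hmp := measurePreserving_add_right (volume : Measure ℝ) d
    refine IntegrableOn.mono_set ((hmp.integrableOn_comp_preimage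
      (measurableEmbedding_addRight d)).2 (hloc (R + |d|))) fun y hy => ?_
    have h1 := le_abs_self d
    have h2 := neg_abs_le d
    exact ⟨by linarith [hy.1], by linarith [hy.2]⟩
  -- One third of `ε` pays for lowering both values, as the masses sum to one; one third is `η`, and
  -- one third gives the strict inequality required by `le_integral_pi_cons`.
  obtain ⟨Q, hQ, hQi, hQc, hQge⟩ := exists_relaxed_integral_ge (μ := μ) (r := r) hΔt hσ
    (g := fun y => f (S₀ * Real.exp (σ * (y + d)))) (by fun_prop) hloc' (p := (u, v))
    (a := f a - ε / 3) (b := f b - ε / 3) hud hvd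
    (hpre u _ (by rw [hfa]; linarith)) (hpre v _ (by rw [hfb]; linarith))
    (η := ε / 3) (by positivity)
  have hcont : Continuous fun t => ∫ y, f (S₀ * Real.exp (σ * (y + t))) ∂Q := by
    have := hQc.comp (continuous_sub_right d)
    simpa [Function.comp_def, add_assoc] using this
  have := le_integral_pi_cons (c := lossMass (rho μ σ r Δt) (u, v) * (f a - ε / 3)
    + gainMass (rho μ σ r Δt) (u, v) * (f b - ε / 3) - ε / 3 - ε / 3) hΔt hσ hwr hQ hcont
    (lt_of_lt_of_le (by linarith) hQge)
  linear_combination this + ε / 3 * hsum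

/-- When `a = S₀` the chord is just `f S₀`. By `hreg`, points other than `S₀` with `f` above `f S₀ -
ε` accumulate from the left or from the right; a nondegenerate chord ending at such a point puts
mass tending to one on it. -/
theorem chord_le {N : ℕ} {S₀ : ℝ} (hS₀ : 0 < S₀) (hΔt : 0 < Δt) (hσ : 0 < σ) {f : ℝ → ℝ}
    (hf : Measurable f)
    (hreg : ∀ s : ℝ, 0 < s → ∀ c : ℝ, c < f s → ∀ U ∈ 𝓝 s, 0 < volume (U ∩ {t | c < f t}))
    {w : ℝ}
    (hw : ∀ q : Fin (N + 1) → Measure ℝ, (∀ i, q i ∈ oneStepMeasures (stepLaw Δt) (rho μ σ r Δt)) →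
      Integrable (fun y => f (price S₀ μ σ r Δt (N + 1) y)) (Measure.pi q) ∧
        ∫ y, f (price S₀ μ σ r Δt (N + 1) y) ∂Measure.pi q ≤ w)
    {a b : ℝ} (ha : 0 < a) (haS : a ≤ S₀) (hSb : S₀ < b) : chord f S₀ a b ≤ w := by
  have hlt : ∀ a b, 0 < a → a < S₀ → S₀ < b → chord f S₀ a b ≤ w :=
    fun a b ha haS hSb => chord_le_of_lt hS₀ hΔt hσ hf hreg hw ha haS hSb
  rcases haS.lt_or_eq with h | rfl
  · exact hlt a b ha h hSb
  rw [chord_self hSb]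
  refine le_of_forall_pos_le_add fun ε hε => ?_
  have hfreq : ∃ᶠ s in 𝓝[≠] a, f a - ε < f s := by
    rw [frequently_nhdsWithin_iff, Filter.frequently_iff]
    intro U hU
    have := hreg a ha (f a - ε) (by linarith) U hU
    have h2 : volume ((U ∩ {t | f a - ε < f t}) \ {a}) ≠ 0 := by
      rw [measure_sdiff_null (by simp)]; exact this.ne'
    obtain ⟨s, ⟨hsU, hs⟩, hsa⟩ := nonempty_of_measure_ne_zero h2
    exact ⟨s, hsU, hs, hsa⟩
  have hev : ∀ᶠ s in 𝓝[≠] a, 0 < s := nhdsWithin_le_nhds (Ioi_mem_nhds ha)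
  rw [← Set.Iio_union_Ioi, nhdsWithin_union] at hfreq hev
  have hab : b - a ≠ 0 := by linarith
  rcases Filter.frequently_sup.1 hfreq with hfr | hfr
  · have ht : Filter.Tendsto
        (fun s => (b - a) / (b - s) * (f a - ε) + (a - s) / (b - s) * f b) (𝓝[<] a)
        (𝓝 (f a - ε)) := by
      have : ContinuousAt
          (fun s => (b - a) / (b - s) * (f a - ε) + (a - s) / (b - s) * f b) a := by
        fun_prop (disch := assumption)
      have := this.tendsto.mono_left (nhdsWithin_le_nhds (s := Set.Iio a))
      simpa [div_self hab] using this
    have hle : ∃ᶠ s in 𝓝[<] a,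
        (b - a) / (b - s) * (f a - ε) + (a - s) / (b - s) * f b ≤ w := by
      refine (hfr.and_eventually ((Filter.eventually_sup.1 hev).1.and
        self_mem_nhdsWithin)).mono ?_
      rintro s ⟨hs, hs0, hsa⟩
      have hsa' : s < a := hsa
      refine le_trans ?_ (hlt s b hs0 hsa hSb)
      have : 0 ≤ (b - a) / (b - s) := div_nonneg (by linarith) (by linarith)
      unfold chord
      gcongr
    linarith [le_of_tendsto_of_frequently ht hle]
  -- On the right the point `s` is the right end of the chord; the left end `a / 2` is an arbitrary
  -- positive number below `a`.
  · have ha2 : a - a / 2 ≠ 0 := by linarith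
    have ht : Filter.Tendsto
        (fun s => (s - a) / (s - a / 2) * f (a / 2) + (a - a / 2) / (s - a / 2) * (f a - ε))
        (𝓝[>] a) (𝓝 (f a - ε)) := by
      have : ContinuousAt
          (fun s => (s - a) / (s - a / 2) * f (a / 2)
            + (a - a / 2) / (s - a / 2) * (f a - ε)) a := by
        fun_prop (disch := assumption)
      have := this.tendsto.mono_left (nhdsWithin_le_nhds (s := Set.Ioi a))
      simpa [div_self ha2] using this
    have hle : ∃ᶠ s in 𝓝[>] a,
        (s - a) / (s - a / 2) * f (a / 2) + (a - a / 2) / (s - a / 2) * (f a - ε) ≤ w := by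
      refine (hfr.and_eventually (self_mem_nhdsWithin)).mono ?_
      rintro s ⟨hs, hsa⟩
      have hsa' : a < s := hsa
      refine le_trans ?_ (hlt (a / 2) s (by positivity) (by linarith) hsa)
      have : 0 ≤ (a - a / 2) / (s - a / 2) := div_nonneg (by linarith) (by linarith)
      unfold chord
      gcongr
    linarith [le_of_tendsto_of_frequently ht hle]

end Model

/-! ### The fair price -/

section Price

variable {N : ℕ} {S₀ μ σ r Δt : ℝ} {f : ℝ → ℝ}

theorem pi_mem_martingaleMeasures {q : Fin N → Measure ℝ}
    (hq : ∀ i, q i ∈ oneStepMeasures (stepLaw Δt) (rho μ σ r Δt)) :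
    Measure.pi q ∈ martingaleMeasures μ σ r Δt N :=
  subset_convexHull _ _ ⟨q, hq, rfl⟩

theorem martingaleMeasures_nonempty (hΔt : 0 < Δt) (hσ : 0 < σ) :
    (martingaleMeasures μ σ r Δt N).Nonempty :=
  ⟨_, pi_mem_martingaleMeasures fun _ => twoPointMixture_pairProb_mem (measurable_rho _ _ _ _)
    (fun u => (one_add_rho_pos _ _ _ _ u).le) (stepLaw_lossSet_ne_zero hΔt hσ)
    (stepLaw_gainSet_ne_zero hΔt hσ)⟩

theorem integral_le_of_mem_martingaleMeasures {x : ℝ}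
    (hint : ∀ Q ∈ martingaleMeasures μ σ r Δt N, Integrable (fun y => f (price S₀ μ σ r Δt N y)) Q)
    (hx : x ∈ superHedgeCapitals S₀ μ σ r Δt N f) {Q : Measure (Path N)}
    (hQ : Q ∈ martingaleMeasures μ σ r Δt N) : ∫ y, f (price S₀ μ σ r Δt N y) ∂Q ≤ x := by
  have hρ := measurable_rho μ σ r Δt
  have hconv : Convex ℝ≥0 {Q : Measure (Path N) |
      Integrable (fun y => f (price S₀ μ σ r Δt N y)) Q ∧
        ∫ y, f (price S₀ μ σ r Δt N y) ∂Q ≤ x} := by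
    -- Both properties survive convex combinations, so only product measures have to be checked.
    rintro A ⟨hA, hA'⟩ B ⟨hB, hB'⟩ a b - - hab
    have iA := hA.smul_measure_nnreal (c := a)
    have iB := hB.smul_measure_nnreal (c := b)
    refine ⟨iA.add_measure iB, ?_⟩
    rw [integral_add_measure iA iB, integral_smul_nnreal_measure, integral_smul_nnreal_measure]
    have hab' : (a : ℝ) + b = 1 := by exact_mod_cast hab
    calc _ ≤ (a : ℝ) * x + b * x := add_le_add
          (mul_le_mul_of_nonneg_left hA' a.coe_nonneg) (mul_le_mul_of_nonneg_left hB' b.coe_nonneg)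
      _ = x := by rw [← add_mul, hab', one_mul]
  refine (convexHull_min ?_ hconv hQ).2
  rintro _ ⟨q, hq, rfl⟩
  have hq' := fun i => oneStepMeasures_subset_relaxedMeasures hρ (hq i)
  have hmean := fun i => hasMeanZero_of_mem_relaxedMeasures hρ
    (fun u => (one_add_rho_pos μ σ r Δt u).le) (hq' i)
  have := fun i => isProbabilityMeasure_of_mem_relaxedMeasures hρ (hq' i)
  have hi := hint _ (pi_mem_martingaleMeasures hq)
  exact ⟨hi, integral_le_of_mem_superHedgeCapitals hx
    (fun i => absolutelyContinuous_of_mem_relaxedMeasures (hq' i)) (fun i => (hmean i).1)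
    (fun i => (hmean i).2) hi⟩

theorem mem_superHedgeCapitals_of_supporting_line (hS₀ : 0 < S₀) {V h : ℝ}
    (hf : ∀ t, 0 < t → f t ≤ V + h * (t - S₀)) : V ∈ superHedgeCapitals S₀ μ σ r Δt N f := by
  refine ⟨fun _ _ => h, fun i => measurable_const, .of_forall fun y => ?_⟩
  rw [← Finset.mul_sum, sum_price_sub]
  exact hf _ (mul_pos hS₀ (Real.exp_pos _))

theorem superHedgePrice_le {x : ℝ} (hx : x ∈ superHedgeCapitals S₀ μ σ r Δt N f) :
    superHedgePrice S₀ μ σ r Δt N f ≤ x := iInf₂_le x hx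

theorem iSup_integral_le_superHedgePrice
    (hint : ∀ Q ∈ martingaleMeasures μ σ r Δt N,
      Integrable (fun y => f (price S₀ μ σ r Δt N y)) Q) :
    (⨆ Q ∈ martingaleMeasures μ σ r Δt N, ((∫ y, f (price S₀ μ σ r Δt N y) ∂Q : ℝ) : EReal))
      ≤ superHedgePrice S₀ μ σ r Δt N f :=
  iSup₂_le fun _ hQ => le_iInf₂ fun _ hx =>
    EReal.coe_le_coe_iff.2 (integral_le_of_mem_martingaleMeasures hint hx hQ)

theorem superHedgePrice_le_iSup_twoPointValue_le (hS₀ : 0 < S₀) (hΔt : 0 < Δt) (hσ : 0 < σ) (hf : Measurable f)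
    (hreg : ∀ s : ℝ, 0 < s → ∀ c : ℝ, c < f s → ∀ U ∈ 𝓝 s, 0 < volume (U ∩ {t | c < f t}))
    (hint : ∀ Q ∈ martingaleMeasures μ σ r Δt (N + 1),
      Integrable (fun y => f (price S₀ μ σ r Δt (N + 1) y)) Q)
    (hsup : (⨆ Q ∈ martingaleMeasures μ σ r Δt (N + 1),
      ((∫ y, f (price S₀ μ σ r Δt (N + 1) y) ∂Q : ℝ) : EReal)) < ⊤) :
    superHedgePrice S₀ μ σ r Δt (N + 1) f ≤ (⨆ y ∈ pairFamilies μ σ r Δt (N + 1),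
        ((twoPointValue S₀ μ σ r Δt (N + 1) f y : ℝ) : EReal)) ∧
      (⨆ y ∈ pairFamilies μ σ r Δt (N + 1),
        ((twoPointValue S₀ μ σ r Δt (N + 1) f y : ℝ) : EReal)) ≤
      ⨆ Q ∈ martingaleMeasures μ σ r Δt (N + 1),
        ((∫ y, f (price S₀ μ σ r Δt (N + 1) y) ∂Q : ℝ) : EReal) := by
  set W := ⨆ Q ∈ martingaleMeasures μ σ r Δt (N + 1),
    ((∫ y, f (price S₀ μ σ r Δt (N + 1) y) ∂Q : ℝ) : EReal) with hW
  set T := ⨆ y ∈ pairFamilies μ σ r Δt (N + 1),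
    ((twoPointValue S₀ μ σ r Δt (N + 1) f y : ℝ) : EReal) with hT
  have hleW : ∀ Q ∈ martingaleMeasures μ σ r Δt (N + 1),
      ((∫ y, f (price S₀ μ σ r Δt (N + 1) y) ∂Q : ℝ) : EReal) ≤ W := fun Q hQ =>
    le_iSup₂ (f := fun (Q : Measure (Path (N + 1))) (_ : Q ∈ martingaleMeasures μ σ r Δt (N + 1)) =>
      ((∫ y, f (price S₀ μ σ r Δt (N + 1) y) ∂Q : ℝ) : EReal)) Q hQ
  have hleT : ∀ y ∈ pairFamilies μ σ r Δt (N + 1),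
      ((twoPointValue S₀ μ σ r Δt (N + 1) f y : ℝ) : EReal) ≤ T := fun y hy =>
    le_iSup₂ (f := fun (y : Fin (N + 1) → Fin 2 → ℝ) (_ : y ∈ pairFamilies μ σ r Δt (N + 1)) =>
      ((twoPointValue S₀ μ σ r Δt (N + 1) f y : ℝ) : EReal)) y hy
  obtain ⟨Q₀, hQ₀⟩ := martingaleMeasures_nonempty (N := N + 1) (μ := μ) (r := r) hΔt hσ
  have hWbot : W ≠ ⊥ := ne_bot_of_le_ne_bot (EReal.coe_ne_bot _) (hleW Q₀ hQ₀)
  have hWr := EReal.coe_toReal hsup.ne hWbot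
  have hTW : T ≤ W := by
    -- A line of height `W` at `S₀` dominates `f`, which bounds all two-point values at once and not
    -- only the chords.
    obtain ⟨h, hh⟩ := exists_supporting_line (f := f) (V := W.toReal) hS₀
      fun a b ha haS hSb => chord_le (μ := μ) (r := r) hS₀ hΔt hσ hf hreg (N := N) (fun q hq =>
        ⟨hint _ (pi_mem_martingaleMeasures hq), EReal.coe_le_coe_iff.1
          ((hleW _ (pi_mem_martingaleMeasures hq)).trans_eq hWr.symm)⟩) ha haS hSb
    rw [← hWr]
    exact iSup₂_le fun y hy => EReal.coe_le_coe_iff.2 (twoPointValue_le hS₀ hσ hh hy)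
  refine ⟨?_, hTW⟩
  -- Any family of pairs would do: it only shows that `T` is not `⊥`.
  obtain ⟨y₀, hy₀, -⟩ := exists_twoPointValue_eq_chord (N := N) (μ := μ) (r := r) (Δt := Δt) hS₀ hσ f
    hS₀ le_rfl (lt_add_one S₀)
  have hTbot : T ≠ ⊥ := ne_bot_of_le_ne_bot (EReal.coe_ne_bot _) (hleT y₀ hy₀)
  have hTr := EReal.coe_toReal (hTW.trans_lt hsup).ne hTbot
  obtain ⟨h, hh⟩ := exists_supporting_line (f := f) (V := T.toReal) hS₀ fun a b ha haS hSb => by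
    obtain ⟨y, hy, he⟩ := exists_twoPointValue_eq_chord (N := N) (μ := μ) (r := r) (Δt := Δt)
      hS₀ hσ f ha haS hSb
    rw [← he]
    exact EReal.coe_le_coe_iff.1 ((hleT y hy).trans_eq hTr.symm)
  rw [← hTr]
  exact superHedgePrice_le (mem_superHedgeCapitals_of_supporting_line hS₀ hh)

/-- Without a period there is no first pair to carry a chord, but the payment is the constant `f
S₀`. -/
theorem superHedgePrice_le_iSup_twoPointValue_le_zero :
    superHedgePrice S₀ μ σ r Δt 0 f ≤ (⨆ y ∈ pairFamilies μ σ r Δt 0,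
        ((twoPointValue S₀ μ σ r Δt 0 f y : ℝ) : EReal)) ∧
      (⨆ y ∈ pairFamilies μ σ r Δt 0,
        ((twoPointValue S₀ μ σ r Δt 0 f y : ℝ) : EReal)) ≤
      ⨆ Q ∈ martingaleMeasures μ σ r Δt 0,
        ((∫ y, f (price S₀ μ σ r Δt 0 y) ∂Q : ℝ) : EReal) := by
  have hT : ∀ y, twoPointValue S₀ μ σ r Δt 0 f y = f S₀ := fun y => by simp [twoPointValue]
  constructor
  · refine (superHedgePrice_le (x := f S₀) ⟨fun _ _ => 0, fun i => measurable_const,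
      .of_forall fun y => by simp [price_zero]⟩).trans ?_
    refine le_iSup₂_of_le (f := fun (y : Fin 0 → Fin 2 → ℝ) (_ : y ∈ pairFamilies μ σ r Δt 0) =>
      ((twoPointValue S₀ μ σ r Δt 0 f y : ℝ) : EReal)) finZeroElim (fun s => s.elim0) ?_
    rw [hT]
  · refine iSup₂_le fun y _ => ?_
    refine le_iSup₂_of_le (f := fun (Q : Measure (Path 0)) (_ : Q ∈ martingaleMeasures μ σ r Δt 0) =>
      ((∫ y, f (price S₀ μ σ r Δt 0 y) ∂Q : ℝ) : EReal)) (Measure.pi finZeroElim)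
      (pi_mem_martingaleMeasures fun i => i.elim0) ?_
    rw [hT]
    simp [price_zero, Measure.real, Measure.pi_empty_univ]

end Price

end DriftedGBM

/-! ### The duality theorem. -/

theorem mainTheorem6
    (N : ℕ) (S₀ μ σ r Δt : ℝ) (hS₀ : 0 < S₀) (hΔt : 0 < Δt) (hσ : 0 < σ)
    (hσΔt : σ < 1 / (2 * Δt))
    (f : ℝ → ℝ) (hf : Measurable f)
    (hreg : ∀ s : ℝ, 0 < s → ∀ c : ℝ, c < f s → ∀ U ∈ 𝓝 s, 0 < volume (U ∩ {t | c < f t}))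
    (hint : ∀ Q ∈ DriftedGBM.martingaleMeasures μ σ r Δt N,
      Integrable (fun y => f (DriftedGBM.price S₀ μ σ r Δt N y)) Q)
    (hsup : (⨆ Q ∈ DriftedGBM.martingaleMeasures μ σ r Δt N,
      ((∫ y, f (DriftedGBM.price S₀ μ σ r Δt N y) ∂Q : ℝ) : EReal)) < ⊤) :
    DriftedGBM.superHedgePrice S₀ μ σ r Δt N f
        = ⨆ Q ∈ DriftedGBM.martingaleMeasures μ σ r Δt N,
            ((∫ y, f (DriftedGBM.price S₀ μ σ r Δt N y) ∂Q : ℝ) : EReal) ∧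
    (⨆ Q ∈ DriftedGBM.martingaleMeasures μ σ r Δt N,
        ((∫ y, f (DriftedGBM.price S₀ μ σ r Δt N y) ∂Q : ℝ) : EReal))
        = ⨆ y ∈ DriftedGBM.pairFamilies μ σ r Δt N,
            ((DriftedGBM.twoPointValue S₀ μ σ r Δt N f y : ℝ) : EReal) := by
  have h : DriftedGBM.superHedgePrice S₀ μ σ r Δt N f ≤
        (⨆ y ∈ DriftedGBM.pairFamilies μ σ r Δt N,
          ((DriftedGBM.twoPointValue S₀ μ σ r Δt N f y : ℝ) : EReal)) ∧
      (⨆ y ∈ DriftedGBM.pairFamilies μ σ r Δt N,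
          ((DriftedGBM.twoPointValue S₀ μ σ r Δt N f y : ℝ) : EReal)) ≤
        ⨆ Q ∈ DriftedGBM.martingaleMeasures μ σ r Δt N,
          ((∫ y, f (DriftedGBM.price S₀ μ σ r Δt N y) ∂Q : ℝ) : EReal) := by
    cases N with
    | zero => exact DriftedGBM.superHedgePrice_le_iSup_twoPointValue_le_zero
    | succ N => exact DriftedGBM.superHedgePrice_le_iSup_twoPointValue_le hS₀ hΔt hσ hf hreg hint hsup
  have hweak := DriftedGBM.iSup_integral_le_superHedgePrice hint
  exact ⟨le_antisymm (h.1.trans h.2) hweak, le_antisymm (hweak.trans h.1) h.2⟩
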